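/- Let $N\in\{2,3\}$, let $D_0\subset\mathbb R^N$ be nonempty, open, bounded and simply connected, let $\Omega_0\subsetneq D_0$ be nonempty, open and simply connected, and put $S_0=D_0\setminus\overline{\Omega}_0$. Suppose $$\partial\Omega_0=I_0\cup\Gamma_0\cup O_0,\qquad \partial S_0=Z_0\cup\Sigma_0\cup\Gamma_0\cup\Pi_0,\qquad \partial D_0=I_0\cup Z_0\cup\Sigma_0\cup\Pi_0\cup O_0,$$ where $I_0\ne\emptyset$, $O_0\neq\emptyset$, $I_0\cup Z_0\subset\{x_1=0\}$, $O_0\cup\Pi_0\subset\{x_1=\ell\}$ for some $\ell\in\mathbb R$, and $\Gamma_0=\{x\in D_0:\gamma_0(x)=0\}$ with $\gamma_0\in C^2(\overline D_0)$. (A function is in $C^2(\overline D_0)$ if it is $C^2$ in $D_0$ and its derivatives of order at most $2$ extend continuously to $\overline D_0$.) Let $$\Lambda=\Big\{\lambda\in C^2(\overline D_0,\mathbb R^N):\ \lambda=0\text{ on }\partial D_0,\ \ \sum_{j=2}^N\partial_1\lambda_j\,\partial_j\gamma_0=0\ \text{ on }\partial\Gamma_0:=\overline{\Gamma}_0\cap\partial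 D_0\Big\}.$$ Let $p_S^0\in\mathbb R$, $k_S>0$, $G_S>0$ with $k_S-\frac23G_S\ge0$. For a displacement $U$ write $(\nabla U)_{ij}=\partial_iU_j$ and (without summation over repeated indices) $$\epsilon^0_{ij}(U)=\big(k_S-\tfrac23G_S\big)(\nabla U)_{ij}\delta_{ij}+G_S\big((\nabla U)_{ij}+(\nabla U)_{ji}\big),\qquad \sigma^0(U)=-p_S^0I+\epsilon^0(U),$$ and $a:b=\sum_{i,j}a_{ij}b_{ij}$. Let $H^1_0(S_0,\mathbb R^N)$ be the closure of $C_c^\infty(S_0,\mathbb R^N)$ in $H^1(S_0,\mathbb R^N)$. For $T\subset\partial S_0$, a field $U\in H^1(S_0,\mathbb R^N)$ satisfies $U=g$ on $T$ (in the sense of $H^1$) if it is a limit in $H^1(S_0,\mathbb R^N)$ of fields of $H^1(S_0,\mathbb R^N)\cap C(\overline S_0,\mathbb R^N)$ that equal $g$ at every point of $T$. A weak solution of the problem $$-\nabla\cdot\sigma^0(U^0)=0\ \text{ in }S_0,\qquad U^0=0\ \text{ on }Z_0\cup\Sigma_0\cup\Pi_0,\qquad U^0=\lambda\ \text{ on }\Gamma_0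 \tag{1}$$ is a $U^0\in H^1(S_0,\mathbb R^N)$ that satisfies both boundary conditions in this sense and $\int_{S_0}\sigma^0(U^0):\nabla W=0$ for all $W\in H^1_0(S_0,\mathbb R^N)$. Then for every $\lambda\in\Lambda$ problem (1) has a unique weak solution $U^0\in H^1(S_0,\mathbb R^N)$. Moreover $U^0=\lambda+V^0$, where $V^0$ is the unique element of $H^1_0(S_0,\mathbb R^N)$ with $$\int_{S_0}\epsilon^0(V^0):\nabla W=\int_{S_0}\big(p_S^0I-\epsilon^0(\lambda)\big):\nabla W\qquad\text{for all }W\in H^1_0(S_0,\mathbb R^N).$$ -/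

import Mathlib

open MeasureTheory Set Filter Topology
open scoped ContDiff

noncomputable section

namespace PoreElasticity

/-- `ℝᴺ` with its Euclidean norm and Lebesgue measure. -/
abbrev E (N : ℕ) := EuclideanSpace ℝ (Fin N)

/-- Real `N × N` matrices with the Frobenius norm; the entry `a_{ij}` of `a` is `a (i, j)`. -/
abbrev Mat (N : ℕ) := EuclideanSpace ℝ (Fin N × Fin N)

/-- `e i` is the `i`-th vector of the standard basis. -/
def e {N : ℕ} (i : Fin N) : E N := EuclideanSpace.single i 1

/-- The class `C²` on the closure of an open set `D`: `f` is `C²` in `D`, continuous on the closure,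
and the derivatives of order at most two extend continuously to the closure of `D`. -/
def IsC2OnClosure {N : ℕ} {F : Type*} [NormedAddCommGroup F] [NormedSpace ℝ F]
    (D : Set (E N)) (f : E N → F) : Prop :=
  ContDiffOn ℝ 2 f D ∧ ContinuousOn f (closure D) ∧
    ∀ k : ℕ, k ≤ 2 → ∃ g, ContinuousOn g (closure D) ∧ EqOn g (iteratedFDeriv ℝ k f) D

/-- The partial derivative `∂_i f` at a point of the closure of `D`: the continuous extension of
`∂_i f` from `D`. -/
def partialExt {N : ℕ} {F : Type*} [NormedAddCommGroup F] [NormedSpace ℝ F]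
    (D : Set (E N)) (f : E N → F) (i : Fin N) : E N → F :=
  extendFrom D (fun x => fderiv ℝ f x (e i))

/-- The reference configuration: the whole body `D`, the channel `Ω`, and the pieces of the
boundaries of `D`, `Ω` and of the elastomer `S = D \ closure Ω`. The first coordinate of `x` is
`x 0`. The interface `Γ` is the zero set in `D` of the `C²` function `γ₀`. -/
structure RefConfig (N : ℕ) [NeZero N] where
  D : Set (E N)
  Ω : Set (E N)
  I : Set (E N)
  O : Set (E N)
  Z : Set (E N)
  Sig : Set (E N)
  Pi : Set (E N)
  Γ : Set (E N)
  ℓ : ℝ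
  γ₀ : E N → ℝ
  isOpen_D : IsOpen D
  bounded_D : Bornology.IsBounded D
  nonempty_D : D.Nonempty
  simplyConnected_D : IsSimplyConnected D
  isOpen_Ω : IsOpen Ω
  nonempty_Ω : Ω.Nonempty
  simplyConnected_Ω : IsSimplyConnected Ω
  Ω_ssubset_D : Ω ⊂ D
  frontier_Ω : frontier Ω = I ∪ Γ ∪ O
  frontier_S : frontier (D \ closure Ω) = Z ∪ Sig ∪ Γ ∪ Pi
  frontier_D : frontier D = I ∪ Z ∪ Sig ∪ Pi ∪ O
  nonempty_I : I.Nonempty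
  nonempty_O : O.Nonempty
  IZ_subset : I ∪ Z ⊆ {x | x 0 = 0}
  OPi_subset : O ∪ Pi ⊆ {x | x 0 = ℓ}
  γ₀_C2 : IsC2OnClosure D γ₀
  Γ_eq : Γ = {x | x ∈ D ∧ γ₀ x = 0}

/-- The elastomer `S = D \ closure Ω`. -/
def RefConfig.S {N : ℕ} [NeZero N] (C : RefConfig N) : Set (E N) := C.D \ closure C.Ω

/-- The space `Λ` of admissible deformations `λ`: `C²` on the closure of `D`, zero on `∂D`, and
`∑_{j ≥ 2} ∂₁λ_j ∂_jγ₀ = 0` on `∂Γ`, the set of points at which the interface meets `∂D`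
(the coordinate numbered `1` in the usual notation has index `0` here). -/
def RefConfig.Admissible {N : ℕ} [NeZero N] (C : RefConfig N) : Set (E N → E N) :=
  {lam | IsC2OnClosure C.D lam ∧ (∀ x ∈ frontier C.D, lam x = 0) ∧
    ∀ x ∈ closure C.Γ ∩ frontier C.D,
      ∑ j ∈ Finset.univ.erase (0 : Fin N),
        (partialExt C.D lam 0 x) j * partialExt C.D C.γ₀ j x = 0}

section Sobolev

variable {N : ℕ}

/-- `L²(S, F)`. -/
abbrev L2 (S : Set (E N)) (F : Type) [NormedAddCommGroup F] := Lp F 2 (volume.restrict S)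

/-- `C_c^∞(S, F)`. -/
def IsTest {F : Type} [NormedAddCommGroup F] [NormedSpace ℝ F] (S : Set (E N)) (φ : E N → F) :
    Prop :=
  ContDiff ℝ ∞ φ ∧ HasCompactSupport φ ∧ tsupport φ ⊆ S

/-- `G` is the weak gradient of `u` in `S`: `G_{ij} = ∂_i u_j` in the sense of distributions. -/
def IsWeakGrad (S : Set (E N)) (u : E N → E N) (G : E N → Mat N) : Prop :=
  ∀ φ : E N → ℝ, IsTest S φ → ∀ i j : Fin N,
    ∫ x in S, u x j * fderiv ℝ φ x (e i) = - ∫ x in S, G x (i, j) * φ x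

theorem memLp_coord {ι : Type} [Fintype ι] {S : Set (E N)} (u : L2 S (EuclideanSpace ℝ ι))
    (j : ι) : MemLp (fun x => u x j) 2 (volume.restrict S) :=
  (EuclideanSpace.proj j : EuclideanSpace ℝ ι →L[ℝ] ℝ).comp_memLp u

theorem integrable_coord_mul {ι : Type} [Fintype ι] {S : Set (E N)}
    (u : L2 S (EuclideanSpace ℝ ι)) (j : ι) {g : E N → ℝ} (hg : Continuous g)
    (hc : HasCompactSupport g) : Integrable (fun x => u x j * g x) (volume.restrict S) :=
  (memLp_coord u j).integrable_mul
    ((hg.memLp_of_hasCompactSupport (p := 2) (μ := volume) hc).restrict S)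

theorem IsTest.continuous_partial {S : Set (E N)} {φ : E N → ℝ} (h : IsTest S φ) (i : Fin N) :
    Continuous (fun x => fderiv ℝ φ x (e i)) :=
  (h.1.continuous_fderiv (by simp)).clm_apply continuous_const

theorem IsTest.compact_partial {S : Set (E N)} {φ : E N → ℝ} (h : IsTest S φ) (i : Fin N) :
    HasCompactSupport (fun x => fderiv ℝ φ x (e i)) :=
  h.2.1.fderiv_apply ℝ (e i)

/-- `H¹(S, ℝᴺ)`: the pairs `(u, ∇u)` of an `L²` field and its (unique) `L²` weak gradient. The
inherited norm is `(‖u‖² + ‖∇u‖²)^{1/2}`. -/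
def H1 (S : Set (E N)) : Submodule ℝ (WithLp 2 (L2 S (E N) × L2 S (Mat N))) where
  carrier := {p | IsWeakGrad S p.fst p.snd}
  zero_mem' := by
    intro φ hφ i j
    have h1 : (fun x => (0 : L2 S (E N)) x j * fderiv ℝ φ x (e i))
        =ᵐ[volume.restrict S] fun _ => (0 : ℝ) := by
      filter_upwards [Lp.coeFn_zero (E N) 2 (volume.restrict S)] with x hx
      rw [hx]; simp
    have h2 : (fun x => (0 : L2 S (Mat N)) x (i, j) * φ x)
        =ᵐ[volume.restrict S] fun _ => (0 : ℝ) := by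
      filter_upwards [Lp.coeFn_zero (Mat N) 2 (volume.restrict S)] with x hx
      rw [hx]; simp
    rw [WithLp.zero_fst, WithLp.zero_snd, integral_congr_ae h1, integral_congr_ae h2]
    simp
  add_mem' := by
    intro p q hp hq φ hφ i j
    have h1 : (fun x => (p.fst + q.fst) x j * fderiv ℝ φ x (e i)) =ᵐ[volume.restrict S]
        fun x => p.fst x j * fderiv ℝ φ x (e i) + q.fst x j * fderiv ℝ φ x (e i) := by
      filter_upwards [Lp.coeFn_add p.fst q.fst] with x hx
      rw [hx]; simp [add_mul]
    have h2 : (fun x => (p.snd + q.snd) x (i, j) * φ x) =ᵐ[volume.restrict S]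
        fun x => p.snd x (i, j) * φ x + q.snd x (i, j) * φ x := by
      filter_upwards [Lp.coeFn_add p.snd q.snd] with x hx
      rw [hx]; simp [add_mul]
    have c := hφ.continuous_partial i
    have k := hφ.compact_partial i
    rw [WithLp.add_fst, WithLp.add_snd, integral_congr_ae h1, integral_congr_ae h2,
      integral_add (integrable_coord_mul _ _ c k) (integrable_coord_mul _ _ c k),
      integral_add (integrable_coord_mul _ _ hφ.1.continuous hφ.2.1)
        (integrable_coord_mul _ _ hφ.1.continuous hφ.2.1), hp φ hφ i j, hq φ hφ i j]
    ring
  smul_mem' := by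
    intro c p hp φ hφ i j
    have h1 : (fun x => (c • p.fst) x j * fderiv ℝ φ x (e i)) =ᵐ[volume.restrict S]
        fun x => c * (p.fst x j * fderiv ℝ φ x (e i)) := by
      filter_upwards [Lp.coeFn_smul c p.fst] with x hx
      rw [hx]; simp [mul_assoc]
    have h2 : (fun x => (c • p.snd) x (i, j) * φ x) =ᵐ[volume.restrict S]
        fun x => c * (p.snd x (i, j) * φ x) := by
      filter_upwards [Lp.coeFn_smul c p.snd] with x hx
      rw [hx]; simp [mul_assoc]
    rw [WithLp.smul_fst, WithLp.smul_snd, integral_congr_ae h1, integral_congr_ae h2,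
      integral_const_mul, integral_const_mul, hp φ hφ i j]
    ring

variable {S : Set (E N)}

/-- The underlying field of an element of `H¹(S, ℝᴺ)`. -/
def val (U : H1 S) : L2 S (E N) := U.1.fst

/-- The weak gradient of an element of `H¹(S, ℝᴺ)`; its `(i, j)` entry is `∂_i U_j`. -/
def grad (U : H1 S) : L2 S (Mat N) := U.1.snd

/-- `H¹₀(S, ℝᴺ)`: the closure in `H¹(S, ℝᴺ)` of `C_c^∞(S, ℝᴺ)`. -/
def H10 (S : Set (E N)) : Set (H1 S) :=
  closure {Φ | ∃ φ : E N → E N, IsTest S φ ∧ val Φ =ᵐ[volume.restrict S] φ}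

/-- `U = g` on the part `T` of `∂S` in the sense of `H¹(S)`: `U` is a limit in `H¹(S)` of fields in
`H¹(S)` that are continuous up to the boundary and equal to `g` at every point of `T`. -/
def HasBoundaryValues (T : Set (E N)) (U : H1 S) (g : E N → E N) : Prop :=
  U ∈ closure {Φ : H1 S | ∃ f : E N → E N, ContinuousOn f (closure S) ∧
    val Φ =ᵐ[volume.restrict S] f ∧ ∀ x ∈ T, f x = g x}

end Sobolev

section Elasticity

variable {N : ℕ}

/-- The contraction `a : b = ∑_{ij} a_{ij} b_{ij}`. -/
def contract (a b : Mat N) : ℝ := ∑ i, ∑ j, a (i, j) * b (i, j)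

/-- `ε⁰` as a function of the displacement gradient `a`:
`ε⁰_{ij} = (k - 2/3 G) a_{ij} δ_{ij} + G (a_{ij} + a_{ji})` (no summation). -/
def elasticPart (k G : ℝ) (a : Mat N) : Mat N :=
  WithLp.toLp 2 fun q => (k - 2 / 3 * G) * (a q * if q.1 = q.2 then 1 else 0)
    + G * (a q + a (q.2, q.1))

/-- The identity matrix. -/
def idMat (N : ℕ) : Mat N := WithLp.toLp 2 fun q => if q.1 = q.2 then 1 else 0

/-- The stress `σ⁰ = -p I + ε⁰` as a function of the displacement gradient. -/
def stress (p k G : ℝ) (a : Mat N) : Mat N := -(p • idMat N) + elasticPart k G a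

/-- The classical gradient matrix `(∂_i f_j)_{ij}`. -/
def gradMat (f : E N → E N) (x : E N) : Mat N :=
  WithLp.toLp 2 fun q => fderiv ℝ f x (e q.1) q.2

variable [NeZero N] (C : RefConfig N)

/-- `U ∈ H¹(S, ℝᴺ)` is a weak solution of `-∇·σ⁰(U) = 0` in `S` with `U = 0` on `Z ∪ Sig ∪ Pi` and
`U = lam` on `Γ`. -/
def IsWeakSolution (p k G : ℝ) (lam : E N → E N) (U : H1 C.S) : Prop :=
  (∀ W ∈ H10 C.S, ∫ x in C.S, contract (stress p k G (grad U x)) (grad W x) = 0) ∧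
    HasBoundaryValues (C.Z ∪ C.Sig ∪ C.Pi) U 0 ∧ HasBoundaryValues C.Γ U lam

/-- `V ∈ H¹₀(S, ℝᴺ)` solves `∫_S ε⁰(V) : ∇W = ∫_S (p I - ε⁰(lam)) : ∇W` for all
`W ∈ H¹₀(S, ℝᴺ)`. -/
def SolvesHomogeneous (p k G : ℝ) (lam : E N → E N) (V : H1 C.S) : Prop :=
  V ∈ H10 C.S ∧ ∀ W ∈ H10 C.S,
    ∫ x in C.S, contract (elasticPart k G (grad V x)) (grad W x) =
      ∫ x in C.S, contract (p • idMat N - elasticPart k G (gradMat lam x)) (grad W x)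

end Elasticity

end PoreElasticity

end

/-! Since `lam` is `C²` up to the boundary of the bounded set `D`, it defines an element `Λ` of
`H¹(S)`. The substitution `U = Λ + V` turns the weak equation for `U` into the homogeneous equation
for `V`, because the stress is affine in the gradient (`integral_contract_stress_add`).

On `H¹₀(S)` the Lax–Milgram theorem applies. For test fields, two integrations by parts give `∫ ∂ᵢφⱼ
∂ⱼφᵢ = ∫ ∂ᵢφᵢ ∂ⱼφⱼ`, so the cross terms of the energy sum to `G ∫ (div φ)² ≥ 0`. The energy is
therefore at least `G ‖∇φ‖²`, and Poincaré's inequality makes it coercive (`energyForm_coercive`).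

Uniqueness of `U` has a subtler point: the two boundary conditions are separate limits, and `∂S` has
no regularity, so no trace theorem is available. What is needed is that a field vanishing on `A` and
on `B`, each in the sense of `H¹`, belongs to `H¹₀(S)` when `A ∪ B` covers `∂S`
(`mem_H10sub_of_hasBoundaryValues`). Take continuous approximations `f`, vanishing on `A`, and `g`,
vanishing on `B`. Compose their components with a smooth Lipschitz `Φ` that vanishes near both axes
and is almost the identity on the diagonal. Then `Φ(f, g)` vanishes near `∂S`, and mollifying `f`
and `g` inside `Φ` gives test fields (`exists_isTest_near`). These are bounded in `H¹` and converge
to the given field only in `L²`, which suffices because a closed subspace is weakly closed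
(`mem_of_bounded_of_tendsto`). -/

noncomputable section

namespace PoreElasticity

/-! ### Weak gradients and integration by parts -/

section Calculus

variable {N : ℕ} {S : Set (E N)}

theorem memLp_apply {ι : Type} [Fintype ι] {μ : Measure (E N)} {u : E N → EuclideanSpace ℝ ι}
    (hu : MemLp u 2 μ) (j : ι) : MemLp (fun x => u x j) 2 μ :=
  (EuclideanSpace.proj j : EuclideanSpace ℝ ι →L[ℝ] ℝ).comp_memLp' hu

theorem memLp_of_apply {ι : Type} [Fintype ι] {μ : Measure (E N)} {u : E N → EuclideanSpace ℝ ι}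
    (hu : ∀ j, MemLp (fun x => u x j) 2 μ) : MemLp u 2 μ :=
  (PiLp.continuousLinearEquiv 2 ℝ (fun _ : ι => ℝ)).symm.toContinuousLinearMap.comp_memLp'
    (MemLp.of_eval hu)

theorem integrable_apply_mul {μ : Measure (E N)} {u g : E N → ℝ}
    (hu : MemLp u 2 (μ.restrict S)) [IsFiniteMeasureOnCompacts μ]
    (hg : Continuous g) (hc : HasCompactSupport g) :
    Integrable (fun x => u x * g x) (μ.restrict S) :=
  hu.integrable_mul ((hg.memLp_of_hasCompactSupport (p := 2) (μ := μ) hc).restrict S)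

theorem IsWeakGrad.congr_ae {u v : E N → E N} {G H : E N → Mat N} (h : IsWeakGrad S u G)
    (huv : u =ᵐ[volume.restrict S] v) (hGH : G =ᵐ[volume.restrict S] H) : IsWeakGrad S v H := by
  intro φ hφ i j
  have h1 : ∫ x in S, u x j * fderiv ℝ φ x (e i) = ∫ x in S, v x j * fderiv ℝ φ x (e i) :=
    integral_congr_ae (by filter_upwards [huv] with x hx; rw [hx])
  have h2 : ∫ x in S, G x (i, j) * φ x = ∫ x in S, H x (i, j) * φ x :=
    integral_congr_ae (by filter_upwards [hGH] with x hx; rw [hx])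
  rw [← h1, ← h2, h φ hφ i j]

/-- The fundamental lemma of the calculus of variations, applied to each entry of `G - H`. -/
theorem IsWeakGrad.ae_eq (hS : IsOpen S) {u : E N → E N} {G H : E N → Mat N}
    (hG : MemLp G 2 (volume.restrict S)) (hH : MemLp H 2 (volume.restrict S))
    (h : IsWeakGrad S u G) (h' : IsWeakGrad S u H) : G =ᵐ[volume.restrict S] H := by
  have key : ∀ q : Fin N × Fin N, ∀ᵐ x ∂(volume.restrict S), G x q - H x q = 0 := by
    intro q
    rw [ae_restrict_iff' hS.measurableSet]
    have hm : MemLp (fun x => G x q - H x q) 2 (volume.restrict S) :=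
      (memLp_apply hG q).sub (memLp_apply hH q)
    refine hS.ae_eq_zero_of_integral_contDiff_smul_eq_zero
      (locallyIntegrableOn_of_locallyIntegrable_restrict (hm.locallyIntegrable (by norm_num))) ?_
    intro φ h1 h2 h3
    have a := h φ ⟨h1, h2, h3⟩ q.1 q.2
    have b := h' φ ⟨h1, h2, h3⟩ q.1 q.2
    rw [← setIntegral_eq_integral_of_forall_compl_eq_zero (s := S)]
    · simp only [smul_eq_mul, mul_comm (φ _), sub_mul]
      rw [integral_sub (integrable_apply_mul (memLp_apply hG q) h1.continuous h2)
        (integrable_apply_mul (memLp_apply hH q) h1.continuous h2)]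
      linarith
    · intro x hx
      rw [image_eq_zero_of_notMem_tsupport (fun hx' => hx (h3 hx')), zero_smul]
  filter_upwards [ae_all_iff.2 key] with x hx
  ext q
  exact sub_eq_zero.1 (hx q)

theorem gradMat_apply (f : E N → E N) (x : E N) (i j : Fin N) :
    gradMat f x (i, j) = fderiv ℝ f x (e i) j := rfl

theorem fderiv_coord {f : E N → E N} {x : E N} (hf : DifferentiableAt ℝ f x) (v : E N)
    (j : Fin N) : fderiv ℝ (fun y => f y j) x v = fderiv ℝ f x v j := by
  have := ((EuclideanSpace.proj j : E N →L[ℝ] ℝ).hasFDerivAt.comp x hf.hasFDerivAt).fderiv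
  exact congrArg (fun L => L v) this

/-- Integration by parts over an open set against a test function. -/
theorem integral_mul_fderiv_of_isTest (hS : IsOpen S) {f φ : E N → ℝ}
    (hf : ContDiffOn ℝ 1 f S) (hφ : ContDiff ℝ 1 φ) (hc : HasCompactSupport φ)
    (hs : tsupport φ ⊆ S) (v : E N) :
    ∫ x in S, f x * fderiv ℝ φ x v = - ∫ x in S, fderiv ℝ f x v * φ x := by
  have hcont : ContinuousOn (fun x => fderiv ℝ f x v) S :=
    (hf.continuousOn_fderiv_of_isOpen hS le_rfl).clm_apply continuousOn_const
  have hφv : Continuous (fun x => fderiv ℝ φ x v) :=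
    (hφ.continuous_fderiv (by simp)).clm_apply continuous_const
  -- `a` is controlled only on `S`, but `b` vanishes near every point outside `S`, so the product is
  -- continuous on the whole space.
  have int : ∀ {a b : E N → ℝ}, ContinuousOn a S → Continuous b → tsupport b ⊆ tsupport φ →
      Integrable (fun x => a x * b x) := by
    intro a b ha hb hb'
    have hcb : HasCompactSupport b := hc.mono' (subset_tsupport b |>.trans hb')
    refine Continuous.integrable_of_hasCompactSupport ?_ hcb.mul_left
    rw [continuous_iff_continuousAt]
    intro x
    by_cases hx : x ∈ S
    · exact (ha.continuousAt (hS.mem_nhds hx)).mul hb.continuousAt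
    · have : (fun x => a x * b x) =ᶠ[𝓝 x] fun _ => 0 := by
        have hx' : x ∉ tsupport b := fun h => hx (hs (hb' h))
        filter_upwards [notMem_tsupport_iff_eventuallyEq.1 hx'] with y hy
        rw [hy]; simp
      exact continuousAt_const.congr this.symm
  have ts : tsupport (fun x => fderiv ℝ φ x v) ⊆ tsupport φ := tsupport_fderiv_apply_subset ℝ v
  rw [setIntegral_eq_integral_of_forall_compl_eq_zero,
    setIntegral_eq_integral_of_forall_compl_eq_zero]
  · refine integral_mul_fderiv_eq_neg_fderiv_mul_of_integrable
      (int hcont hφ.continuous le_rfl) (int hf.continuousOn hφv ts)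
      (int hf.continuousOn hφ.continuous le_rfl) ?_ ?_
    · exact fun x hx => (hf.differentiableOn one_ne_zero).differentiableAt
        (hS.mem_nhds (hs hx))
    · exact fun x _ => hφ.differentiable one_ne_zero x
  · intro x hx
    rw [image_eq_zero_of_notMem_tsupport (fun h => hx (hs h)), mul_zero]
  · intro x hx
    rw [image_eq_zero_of_notMem_tsupport (fun h => hx (hs (ts h))), mul_zero]

theorem isWeakGrad_gradMat (hS : IsOpen S) {f : E N → E N} (hf : ContDiffOn ℝ 1 f S) :
    IsWeakGrad S f (gradMat f) := by
  intro φ hφ i j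
  have hfj : ContDiffOn ℝ 1 (fun x => f x j) S :=
    (EuclideanSpace.proj j : E N →L[ℝ] ℝ).contDiff.comp_contDiffOn hf
  rw [integral_mul_fderiv_of_isTest hS hfj (hφ.1.of_le (by exact_mod_cast le_top)) hφ.2.1 hφ.2.2]
  congr 1
  refine setIntegral_congr_fun hS.measurableSet fun x hx => ?_
  simp only
  rw [fderiv_coord ((hf.differentiableOn one_ne_zero).differentiableAt (hS.mem_nhds hx)),
    gradMat_apply]

end Calculus

/-! ### Completeness of `H¹(S)` and the subspace `H¹₀(S)` -/

section H1

variable {N : ℕ} {S : Set (E N)}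

/-- The element of `H¹(S)` with a given field and weak gradient. -/
def mkH1 {u : E N → E N} {G : E N → Mat N} (hu : MemLp u 2 (volume.restrict S))
    (hG : MemLp G 2 (volume.restrict S)) (h : IsWeakGrad S u G) : H1 S :=
  ⟨WithLp.toLp 2 (hu.toLp u, hG.toLp G),
    h.congr_ae hu.coeFn_toLp.symm hG.coeFn_toLp.symm⟩

theorem val_mkH1 {u : E N → E N} {G : E N → Mat N} (hu : MemLp u 2 (volume.restrict S))
    (hG : MemLp G 2 (volume.restrict S)) (h : IsWeakGrad S u G) :
    val (mkH1 hu hG h) =ᵐ[volume.restrict S] u := hu.coeFn_toLp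

theorem grad_mkH1 {u : E N → E N} {G : E N → Mat N} (hu : MemLp u 2 (volume.restrict S))
    (hG : MemLp G 2 (volume.restrict S)) (h : IsWeakGrad S u G) :
    grad (mkH1 hu hG h) =ᵐ[volume.restrict S] G := hG.coeFn_toLp

theorem isWeakGrad_grad (U : H1 S) : IsWeakGrad S (val U) (grad U) := U.2

/-- `val` as a continuous linear map. -/
def valL (S : Set (E N)) : H1 S →L[ℝ] L2 S (E N) :=
  (WithLp.fstL 2 ℝ (L2 S (E N)) (L2 S (Mat N))).comp (H1 S).subtypeL

/-- `grad` as a continuous linear map. -/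
def gradL (S : Set (E N)) : H1 S →L[ℝ] L2 S (Mat N) :=
  (WithLp.sndL 2 ℝ (L2 S (E N)) (L2 S (Mat N))).comp (H1 S).subtypeL

theorem norm_sq_H1 (U : H1 S) : ‖U‖ ^ 2 = ‖val U‖ ^ 2 + ‖grad U‖ ^ 2 :=
  WithLp.prod_norm_sq_eq_of_L2 U.1

theorem grad_ae_eq (hS : IsOpen S) (U : H1 S) {u : E N → E N} {G : E N → Mat N}
    (hG : MemLp G 2 (volume.restrict S)) (h : IsWeakGrad S u G)
    (hu : val U =ᵐ[volume.restrict S] u) : grad U =ᵐ[volume.restrict S] G :=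
  IsWeakGrad.ae_eq hS (Lp.memLp _) hG
    ((isWeakGrad_grad U).congr_ae hu (ae_eq_refl _)) h

/-- Uniqueness of the weak gradient. It lets an `L²` limit identify a weak limit in `H¹(S)`. -/
theorem valL_injective (hS : IsOpen S) : Function.Injective (valL S) := by
  intro U V h
  have h' : val U = val V := h
  have hg : grad U = grad V :=
    Lp.ext (grad_ae_eq hS U (Lp.memLp _) (isWeakGrad_grad V) (by rw [h']))
  apply Subtype.ext
  exact (WithLp.ofLp_injective 2) (Prod.ext h' hg)

/-- For a fixed test function both sides of the defining identity are `L²` pairings with fixed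
functions, so `H¹(S)` is an intersection of closed sets. This is the source of completeness for
Lax–Milgram. -/
theorem H1_isClosed (S : Set (E N)) :
    IsClosed (H1 S : Set (WithLp 2 (L2 S (E N) × L2 S (Mat N)))) := by
  have key : ∀ {ι : Type} [Fintype ι] (j : ι) {g : E N → ℝ}, Continuous g → HasCompactSupport g →
      Continuous fun u : L2 S (EuclideanSpace ℝ ι) => ∫ x in S, u x j * g x := by
    intro ι _ j g hg hc
    classical
    have hm : MemLp (fun x => EuclideanSpace.single j (g x) : E N → EuclideanSpace ℝ ι) 2
        (volume.restrict S) := by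
      refine memLp_of_apply fun k => ?_
      by_cases h : k = j
      · subst h
        simpa using (hg.memLp_of_hasCompactSupport (p := 2) (μ := volume) hc).restrict S
      · simp [h]
    have : (fun u : L2 S (EuclideanSpace ℝ ι) => ∫ x in S, u x j * g x) =
        fun u => inner ℝ u (hm.toLp _) := by
      funext u
      rw [L2.inner_def]
      refine integral_congr_ae ?_
      filter_upwards [hm.coeFn_toLp] with x hx
      rw [hx, EuclideanSpace.inner_single_right]
      simp [mul_comm]
    rw [this]
    fun_prop
  have : (H1 S : Set (WithLp 2 (L2 S (E N) × L2 S (Mat N)))) =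
      ⋂ φ : {φ : E N → ℝ // IsTest S φ}, ⋂ i : Fin N, ⋂ j : Fin N,
        {p | ∫ x in S, p.fst x j * fderiv ℝ φ.1 x (e i) = - ∫ x in S, p.snd x (i, j) * φ.1 x} := by
    ext p
    simp only [mem_iInter, mem_ofPred_eq, Subtype.forall]
    rfl
  rw [this]
  refine isClosed_iInter fun φ => isClosed_iInter fun i => isClosed_iInter fun j => ?_
  refine isClosed_eq ?_ ?_
  · exact (key j (φ.2.continuous_partial i) (φ.2.compact_partial i)).comp
      (WithLp.fstL 2 ℝ (L2 S (E N)) (L2 S (Mat N))).continuous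
  · exact ((key (i, j) φ.2.1.continuous φ.2.2.1).comp
      (WithLp.sndL 2 ℝ (L2 S (E N)) (L2 S (Mat N))).continuous).neg

instance : CompleteSpace (H1 S) := (H1_isClosed S).completeSpace_coe

/-- Test fields as a submodule of `H¹(S)`. -/
def testSub (S : Set (E N)) : Submodule ℝ (H1 S) where
  carrier := {Φ | ∃ φ : E N → E N, IsTest S φ ∧ val Φ =ᵐ[volume.restrict S] φ}
  zero_mem' := ⟨0, ⟨contDiff_const, HasCompactSupport.zero, by
    simp [tsupport]⟩, Lp.coeFn_zero _ _ _⟩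
  add_mem' := by
    rintro U V ⟨φ, hφ, hU⟩ ⟨ψ, hψ, hV⟩
    refine ⟨φ + ψ, ⟨hφ.1.add hψ.1, hφ.2.1.add hψ.2.1,
      (tsupport_add φ ψ).trans (union_subset hφ.2.2 hψ.2.2)⟩, ?_⟩
    exact (Lp.coeFn_add (val U) (val V)).trans (hU.add hV)
  smul_mem' := by
    rintro c U ⟨φ, hφ, hU⟩
    refine ⟨c • φ, ⟨contDiff_const.smul hφ.1, hφ.2.1.smul_left,
      (tsupport_smul_subset_right (fun _ => c) φ).trans hφ.2.2⟩, ?_⟩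
    exact (Lp.coeFn_smul c (val U)).trans (hU.const_smul c)

/-- `H¹₀(S)` as a submodule. -/
def H10sub (S : Set (E N)) : Submodule ℝ (H1 S) := (testSub S).topologicalClosure

instance : CompleteSpace (H10sub S) :=
  (testSub S).isClosed_topologicalClosure.completeSpace_coe

theorem IsTest.memLp {F : Type} [NormedAddCommGroup F] [NormedSpace ℝ F] {φ : E N → F}
    (h : IsTest S φ) : MemLp φ 2 (volume.restrict S) :=
  (h.1.continuous.memLp_of_hasCompactSupport h.2.1).restrict S

theorem IsTest.coord {φ : E N → E N} (h : IsTest S φ) (j : Fin N) :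
    IsTest S (fun x => φ x j) := by
  have : tsupport (fun x => φ x j) ⊆ tsupport φ :=
    closure_mono fun x hx hx' => hx (by simp [hx'])
  exact ⟨(EuclideanSpace.proj j : E N →L[ℝ] ℝ).contDiff.comp h.1,
    h.2.1.mono' ((subset_tsupport _).trans this), this.trans h.2.2⟩

theorem IsTest.memLp_gradMat {φ : E N → E N} (h : IsTest S φ) :
    MemLp (gradMat φ) 2 (volume.restrict S) := by
  refine memLp_of_apply fun q => ?_
  have := (((h.coord q.2).continuous_partial q.1).memLp_of_hasCompactSupport (p := 2)
    (μ := volume) ((h.coord q.2).compact_partial q.1)).restrict S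
  refine this.congr_norm ?_ ?_
  · have hc : Continuous (fun x => gradMat φ x q) :=
      (EuclideanSpace.proj q.2 : E N →L[ℝ] ℝ).continuous.comp
        ((h.1.continuous_fderiv (by simp)).clm_apply continuous_const)
    exact hc.aestronglyMeasurable
  · refine Eventually.of_forall fun x => ?_
    rw [fderiv_coord ((h.1.differentiable (by simp)) x)]
    rfl

/-- The element of `H¹(S)` given by a test field. -/
def IsTest.toH1 (hS : IsOpen S) {φ : E N → E N} (h : IsTest S φ) : H1 S :=
  mkH1 h.memLp h.memLp_gradMat
    (isWeakGrad_gradMat hS (h.1.of_le (by exact_mod_cast le_top)).contDiffOn)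

theorem IsTest.toH1_mem (hS : IsOpen S) {φ : E N → E N} (h : IsTest S φ) :
    h.toH1 hS ∈ testSub S := ⟨φ, h, val_mkH1 _ _ _⟩

theorem IsTest.grad_ae_eq (hS : IsOpen S) {φ : E N → E N} (h : IsTest S φ) {U : H1 S}
    (hU : val U =ᵐ[volume.restrict S] φ) : grad U =ᵐ[volume.restrict S] gradMat φ :=
  PoreElasticity.grad_ae_eq hS U h.memLp_gradMat
    (isWeakGrad_gradMat hS (h.1.of_le (by exact_mod_cast le_top)).contDiffOn) hU

end H1

/-! ### Hilbert space tools: Lax–Milgram and weak closedness -/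

section LaxMilgram

variable {H : Type*} [NormedAddCommGroup H] [InnerProductSpace ℝ H]

/-- The Lax–Milgram theorem on a subspace. -/
theorem exists_bilin_eq_of_coercive (K : Submodule ℝ H) [CompleteSpace K] (B : H →L[ℝ] H →L[ℝ] ℝ)
    {c : ℝ} (hc : 0 < c) (hB : ∀ u ∈ K, c * ‖u‖ ^ 2 ≤ B u u) (F : H →L[ℝ] ℝ) :
    ∃ v ∈ K, ∀ w ∈ K, B v w = F w := by
  let B' : K →L[ℝ] K →L[ℝ] ℝ := B.bilinearComp K.subtypeL K.subtypeL
  have hB' : IsCoercive B' := by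
    refine ⟨c, hc, fun u => ?_⟩
    have := hB u u.2
    rwa [sq, ← mul_assoc] at this
  let f := (InnerProductSpace.toDual ℝ K).symm (F.comp K.subtypeL)
  refine ⟨hB'.continuousLinearEquivOfBilin.symm f, Subtype.mem _, fun w hw => ?_⟩
  have h := hB'.continuousLinearEquivOfBilin_apply (hB'.continuousLinearEquivOfBilin.symm f) ⟨w, hw⟩
  rw [ContinuousLinearEquiv.apply_symm_apply, InnerProductSpace.toDual_symm_apply] at h
  exact h.symm

theorem eq_of_bilin_eq_of_coercive (K : Submodule ℝ H) (B : H →L[ℝ] H →L[ℝ] ℝ)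
    {c : ℝ} (hc : 0 < c) (hB : ∀ u ∈ K, c * ‖u‖ ^ 2 ≤ B u u) {u v : H} (hu : u ∈ K) (hv : v ∈ K)
    (h : ∀ w ∈ K, B u w = B v w) : u = v := by
  have h1 := hB _ (sub_mem hu hv)
  have h2 : B (u - v) (u - v) = 0 := by
    have := h _ (sub_mem hu hv)
    rw [map_sub B u v, sub_apply, this, sub_self]
  rw [h2] at h1
  have h3 : ‖u - v‖ ^ 2 = 0 := le_antisymm (nonpos_of_mul_nonpos_right h1 hc) (sq_nonneg _)
  exact sub_eq_zero.1 (norm_eq_zero.1 ((pow_eq_zero_iff two_ne_zero).1 h3))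

/-- If a bounded sequence of a complete subspace converges after composition with an injective
continuous linear map, then the limit comes from the subspace. -/
theorem mem_of_bounded_of_tendsto {X : Type*} [NormedAddCommGroup X] [InnerProductSpace ℝ X]
    [CompleteSpace H] [CompleteSpace X] (K : Submodule ℝ H) [CompleteSpace K] (T : H →L[ℝ] X)
    (hT : Function.Injective T) {w : ℕ → H} (hw : ∀ n, w n ∈ K) {M : ℝ} (hM : ∀ n, ‖w n‖ ≤ M)
    {v : H} (h : Tendsto (fun n => T (w n)) atTop (𝓝 (T v))) : v ∈ K := by
  have weak : ∀ z : H, Tendsto (fun n => inner ℝ (w n - v) z) atTop (𝓝 0) := by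
    let A : Submodule ℝ H := (ContinuousLinearMap.adjoint T).range
    -- A vector orthogonal to the range of the adjoint lies in the kernel of `T`, which is trivial.
    have hA : A.topologicalClosure = ⊤ := by
      rw [Submodule.topologicalClosure_eq_top_iff, Submodule.eq_bot_iff]
      intro x hx
      apply hT
      rw [map_zero, ← inner_self_eq_zero (𝕜 := ℝ), ← ContinuousLinearMap.adjoint_inner_left]
      exact hx _ ⟨_, rfl⟩
    intro z
    rw [Metric.tendsto_atTop]
    intro ε hε
    have hM0 : 0 ≤ M := (norm_nonneg _).trans (hM 0)
    have hz : z ∈ closure (A : Set H) := by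
      have : z ∈ A.topologicalClosure := hA ▸ Submodule.mem_top
      exact this
    have hd : 0 < ε / (2 * (M + ‖v‖ + 1)) := by positivity
    obtain ⟨_, ⟨y, rfl⟩, hy⟩ := Metric.mem_closure_iff.1 hz _ hd
    have ht : Tendsto (fun n => inner ℝ (T (w n) - T v) y) atTop (𝓝 0) := by
      have := ((h.sub_const (T v)).inner (tendsto_const_nhds (x := y)) (𝕜 := ℝ))
      simpa using this
    obtain ⟨n₀, hn₀⟩ := Metric.tendsto_atTop.1 ht (ε / 2) (by positivity)
    refine ⟨n₀, fun n hn => ?_⟩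
    have h1 := hn₀ n hn
    rw [dist_zero_right] at h1 ⊢
    -- On the range of the adjoint the pairing is controlled by the convergence of `T (w n)`. The
    -- remainder is small by density of the range and boundedness of `w n`.
    have h2 : inner ℝ (w n - v) z = inner ℝ (T (w n) - T v) y
        + inner ℝ (w n - v) (z - ContinuousLinearMap.adjoint T y) := by
      rw [inner_sub_right, ContinuousLinearMap.adjoint_inner_right, map_sub]
      ring
    have h3 : ‖inner ℝ (w n - v) (z - ContinuousLinearMap.adjoint T y)‖ ≤
        (M + ‖v‖ + 1) * (ε / (2 * (M + ‖v‖ + 1))) := by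
      refine (norm_inner_le_norm _ _).trans (mul_le_mul ?_ ?_ (norm_nonneg _) (by positivity))
      · linarith [norm_sub_le (w n) v, hM n]
      · rw [← dist_eq_norm]; exact hy.le
    have h4 : (M + ‖v‖ + 1) * (ε / (2 * (M + ‖v‖ + 1))) = ε / 2 := by
      field_simp
    rw [h2]
    linarith [norm_add_le (inner ℝ (T (w n) - T v) y)
      (inner ℝ (w n - v) (z - ContinuousLinearMap.adjoint T y))]
  -- `K` is complete, hence equal to its double orthogonal complement, and orthogonality to a fixed
  -- `z` passes to weak limits.
  rw [← K.orthogonal_orthogonal]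
  intro z hz
  have h0 : ∀ n, inner ℝ (w n - v) z = -inner ℝ v z := by
    intro n
    rw [inner_sub_left, hz (w n) (hw n), zero_sub]
  have := weak z
  simp only [h0] at this
  have h5 := tendsto_nhds_unique this tendsto_const_nhds
  rw [real_inner_comm]
  linarith

end LaxMilgram

theorem div_mul_le_of_mul_le_mul {a c x y : ℝ} (hc : 0 < c) (h : a * x ≤ c * y) :
    a / c * x ≤ y := by
  rw [div_mul_eq_mul_div, div_le_iff₀ hc]
  linarith

/-! ### Korn and Poincaré inequalities, coercivity -/

section Inequalities

variable {N : ℕ} {S : Set (E N)}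

/-- `∫ ∂ᵥψ ∂_wφ = ∫ ∂_wψ ∂ᵥφ` for test functions. -/
theorem IsTest.integral_fderiv_mul_swap (hS : IsOpen S) {φ ψ : E N → ℝ} (hφ : IsTest S φ)
    (hψ : IsTest S ψ) (v w : E N) :
    ∫ x in S, fderiv ℝ ψ x v * fderiv ℝ φ x w = ∫ x in S, fderiv ℝ ψ x w * fderiv ℝ φ x v := by
  have h1 : ContDiff ℝ 1 φ := hφ.1.of_le (by exact_mod_cast le_top)
  have h2 : ContDiff ℝ 1 (fderiv ℝ ψ) :=
    hψ.1.fderiv_right (WithTop.coe_le_coe.2 (le_top : (1 + 1 : ℕ∞) ≤ ⊤))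
  have c : ∀ u, ContDiffOn ℝ 1 (fun x => fderiv ℝ ψ x u) S := fun u =>
    (h2.clm_apply contDiff_const).contDiffOn
  have d : ∀ x u z, fderiv ℝ (fun x => fderiv ℝ ψ x u) x z = fderiv ℝ (fderiv ℝ ψ) x z u := by
    intro x u z
    rw [fderiv_clm_apply ((h2.differentiable one_ne_zero) x) (differentiableAt_const u)]
    simp
  -- Both sides become integrals of `φ` against a mixed second derivative of `ψ`, and these agree by
  -- symmetry.
  rw [integral_mul_fderiv_of_isTest hS (c v) h1 hφ.2.1 hφ.2.2,
    integral_mul_fderiv_of_isTest hS (c w) h1 hφ.2.1 hφ.2.2]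
  congr 2
  funext x
  rw [d, d, (hψ.1.contDiffAt.isSymmSndFDerivAt (by
    rw [minSmoothness_of_isRCLikeNormedField]
    exact WithTop.coe_le_coe.2 (le_top : (2 : ℕ∞) ≤ ⊤))).eq]

/-- **Poincaré's inequality** for test functions on a set that is bounded in one direction. -/
theorem IsTest.integral_sq_le (hS : IsOpen S) {φ : E N → ℝ} (hφ : IsTest S φ) (i : Fin N) {R : ℝ}
    (hR : ∀ x ∈ S, |x i| ≤ R) :
    ∫ x in S, φ x ^ 2 ≤ 4 * R ^ 2 * ∫ x in S, fderiv ℝ φ x (e i) ^ 2 := by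
  have hd : ∀ x, HasFDerivAt φ (fderiv ℝ φ x) x := fun x =>
    (hφ.1.differentiable (by simp) x).hasFDerivAt
  have hsq : ∀ x, fderiv ℝ (fun y => φ y ^ 2) x (e i) = 2 * φ x * fderiv ℝ φ x (e i) := by
    intro x
    rw [((hd x).pow 2).fderiv]
    simp
  have hx : ∀ x : E N, HasFDerivAt (fun y : E N => y i) (EuclideanSpace.proj i : E N →L[ℝ] ℝ) x :=
    fun x => (EuclideanSpace.proj i : E N →L[ℝ] ℝ).hasFDerivAt
  have hs : tsupport (fun y => φ y ^ 2) ⊆ tsupport φ :=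
    closure_mono fun x hx hx' => hx (by simp [hx'])
  -- Since `∂ᵢ xᵢ = 1`, this reads `∫ φ² = -∫ 2 xᵢ φ ∂ᵢφ`. Young's inequality with weight `1/2` then
  -- lets half of `∫ φ²` be absorbed, which gives the constant `4 R²`.
  have ibp := integral_mul_fderiv_of_isTest hS (f := fun y : E N => y i)
    ((EuclideanSpace.proj i : E N →L[ℝ] ℝ).contDiff.contDiffOn) (φ := fun y => φ y ^ 2)
    ((hφ.1.pow 2).of_le (by exact_mod_cast le_top)) (hφ.2.1.mono' ((subset_tsupport _).trans hs))
    (hs.trans hφ.2.2) (e i)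
  have h1 : ∀ x : E N, fderiv ℝ (fun y : E N => y i) x (e i) = 1 := by
    intro x
    rw [(hx x).fderiv]
    simp [e]
  simp only [h1, hsq, one_mul] at ibp
  have i1 : Integrable (fun x => φ x ^ 2) (volume.restrict S) := hφ.memLp.integrable_sq
  have i2 : Integrable (fun x => fderiv ℝ φ x (e i) ^ 2) (volume.restrict S) :=
    (((hφ.continuous_partial i).memLp_of_hasCompactSupport (p := 2) (μ := volume)
      (hφ.compact_partial i)).restrict S).integrable_sq
  have i3 : Integrable (fun x : E N => x i * (2 * φ x * fderiv ℝ φ x (e i)))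
      (volume.restrict S) := by
    have c1 : Continuous fun x : E N => x i := (EuclideanSpace.proj i : E N →L[ℝ] ℝ).continuous
    refine Integrable.restrict (Continuous.integrable_of_hasCompactSupport
      (c1.mul ((continuous_const.mul hφ.1.continuous).mul (hφ.continuous_partial i))) ?_)
    exact (hφ.compact_partial i).mul_left.mul_left
  have h2 : -∫ x in S, x i * (2 * φ x * fderiv ℝ φ x (e i)) ≤
      ∫ x in S, (1 / 2 * φ x ^ 2 + 2 * R ^ 2 * fderiv ℝ φ x (e i) ^ 2) := by
    rw [← integral_neg]
    refine setIntegral_mono_on i3.neg ((i1.const_mul _).add (i2.const_mul _)) hS.measurableSet ?_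
    intro x hx
    have : (x i) ^ 2 ≤ R ^ 2 := sq_le_sq' (abs_le.1 (hR x hx)).1 (abs_le.1 (hR x hx)).2
    have h3 := mul_le_mul_of_nonneg_right this (sq_nonneg (fderiv ℝ φ x (e i)))
    nlinarith [sq_nonneg (φ x + 2 * (x i * fderiv ℝ φ x (e i)))]
  rw [integral_add (i1.const_mul _) (i2.const_mul _), integral_const_mul, integral_const_mul] at h2
  linarith

theorem contract_eq_inner (a b : Mat N) : contract a b = inner ℝ a b := by
  simp only [contract, PiLp.inner_apply, Fintype.sum_prod_type]
  simp [mul_comm]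

/-- `ε⁰` as a continuous linear map. -/
def elasticL (N : ℕ) (k G : ℝ) : Mat N →L[ℝ] Mat N :=
  LinearMap.toContinuousLinearMap
    { toFun := elasticPart k G
      map_add' := fun a b => by ext q; simp only [elasticPart, PiLp.add_apply]; ring
      map_smul' := fun c a => by ext q; simp only [elasticPart, PiLp.smul_apply, smul_eq_mul, RingHom.id_apply]; ring }

theorem elasticL_apply (k G : ℝ) (a : Mat N) : elasticL N k G a = elasticPart k G a := rfl

/-- With `δᵢⱼ` applied entrywise, the first term is the sum of the squared diagonal entries, not the
squared trace. Only the last term has no pointwise sign. -/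
theorem contract_elasticPart_self (k G : ℝ) (a : Mat N) :
    contract (elasticPart k G a) a = (k - 2 / 3 * G) * ∑ i, a (i, i) ^ 2
      + G * ∑ i, ∑ j, a (i, j) ^ 2 + G * ∑ i, ∑ j, a (i, j) * a (j, i) := by
  have : ∀ i : Fin N, a (i, i) ^ 2 = ∑ j, (a (i, j) * if i = j then 1 else 0) * a (i, j) := by
    intro i
    simp [sq]
  simp only [contract, elasticPart, this, Finset.mul_sum, ← Finset.sum_add_distrib]
  refine Finset.sum_congr rfl fun i _ => Finset.sum_congr rfl fun j _ => ?_
  ring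

theorem norm_sq_Lp {F : Type} [NormedAddCommGroup F] [InnerProductSpace ℝ F]
    {μ : Measure (E N)} (f : Lp F 2 μ) : ‖f‖ ^ 2 = ∫ x, ‖f x‖ ^ 2 ∂μ := by
  rw [← real_inner_self_eq_norm_sq, L2.inner_def]
  simp only [real_inner_self_eq_norm_sq]

theorem norm_sq_Lp_coord {ι : Type} [Fintype ι]
    {μ : Measure (E N)} (f : Lp (EuclideanSpace ℝ ι) 2 μ) :
    ‖f‖ ^ 2 = ∑ j, ∫ x, f x j ^ 2 ∂μ := by
  rw [norm_sq_Lp, ← integral_finsetSum]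
  · simp only [EuclideanSpace.norm_sq_eq, Real.norm_eq_abs, sq_abs]
  · exact fun j _ => (memLp_apply (Lp.memLp f) j).integrable_sq

/-- The elastic energy form on `L²` gradients. -/
theorem inner_compLp_elasticL (k G : ℝ) (f g : L2 S (Mat N)) :
    inner ℝ ((elasticL N k G).compLp f) g =
      ∫ x in S, contract (elasticPart k G (f x)) (g x) := by
  rw [L2.inner_def]
  refine integral_congr_ae ?_
  filter_upwards [(elasticL N k G).coeFn_compLp f] with x hx
  rw [hx, contract_eq_inner, elasticL_apply]

theorem IsTest.integral_gradMat_mul_swap (hS : IsOpen S) {φ : E N → E N} (hφ : IsTest S φ)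
    (i j : Fin N) : ∫ x in S, gradMat φ x (i, j) * gradMat φ x (j, i) =
      ∫ x in S, gradMat φ x (i, i) * gradMat φ x (j, j) := by
  have hc : ∀ x i j, gradMat φ x (i, j) = fderiv ℝ (fun y => φ y j) x (e i) := by
    intro x i j
    rw [fderiv_coord (hφ.1.differentiable (by simp) x), gradMat_apply]
  simp only [hc]
  rw [(hφ.coord i).integral_fderiv_mul_swap hS (hφ.coord j)]
  simp only [mul_comm]

/-- **Korn's inequality** in `L²` form, for gradients with `∫ a_{ij} a_{ji} = ∫ a_{ii} a_{jj}`. -/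
theorem le_integral_contract_elasticPart {a : E N → Mat N} (ha : MemLp a 2 (volume.restrict S))
    (hswap : ∀ i j, ∫ x in S, a x (i, j) * a x (j, i) = ∫ x in S, a x (i, i) * a x (j, j))
    {k G : ℝ} (hG : 0 < G) (hkG : 0 ≤ k - 2 / 3 * G) :
    G * ∑ q, ∫ x in S, a x q ^ 2 ≤ ∫ x in S, contract (elasticPart k G (a x)) (a x) := by
  have hL : ∀ q, MemLp (fun x => a x q) 2 (volume.restrict S) := memLp_apply ha
  have hi : ∀ q r, Integrable (fun x => a x q * a x r) (volume.restrict S) := fun q r =>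
    (hL q).integrable_mul (hL r)
  have hq : ∀ q, Integrable (fun x => a x q ^ 2) (volume.restrict S) := fun q =>
    (hL q).integrable_sq
  have i1 : Integrable (fun x => ∑ i, a x (i, i) ^ 2) (volume.restrict S) :=
    integrable_finsetSum _ fun i _ => hq _
  have i2 : Integrable (fun x => ∑ i, ∑ j, a x (i, j) ^ 2) (volume.restrict S) :=
    integrable_finsetSum _ fun i _ => integrable_finsetSum _ fun j _ => hq _
  have i3 : Integrable (fun x => ∑ i, ∑ j, a x (i, j) * a x (j, i)) (volume.restrict S) :=
    integrable_finsetSum _ fun i _ => integrable_finsetSum _ fun j _ => hi _ _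
  have e0 : ∫ x in S, contract (elasticPart k G (a x)) (a x) =
      (k - 2 / 3 * G) * (∫ x in S, ∑ i, a x (i, i) ^ 2)
        + G * (∫ x in S, ∑ i, ∑ j, a x (i, j) ^ 2)
        + G * ∫ x in S, ∑ i, ∑ j, a x (i, j) * a x (j, i) := by
    have j12 : Integrable (fun x => (k - 2 / 3 * G) * ∑ i, a x (i, i) ^ 2
        + G * ∑ i, ∑ j, a x (i, j) ^ 2) (volume.restrict S) :=
      (i1.const_mul _).add (i2.const_mul _)
    rw [← integral_const_mul, ← integral_const_mul, ← integral_const_mul,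
      ← integral_add (i1.const_mul _) (i2.const_mul _), ← integral_add j12 (i3.const_mul _)]
    exact integral_congr_ae (Eventually.of_forall fun x => contract_elasticPart_self k G (a x))
  have p1 : 0 ≤ ∫ x in S, ∑ i, a x (i, i) ^ 2 :=
    integral_nonneg fun x => Finset.sum_nonneg fun i _ => sq_nonneg _
  have p2 : ∫ x in S, ∑ i, ∑ j, a x (i, j) ^ 2 = ∑ q, ∫ x in S, a x q ^ 2 := by
    rw [← integral_finsetSum _ fun q _ => hq q]
    simp only [Fintype.sum_prod_type]
  -- The term without a sign becomes a squared divergence after integration, so dropping it leaves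
  -- the full gradient and not just its symmetric part.
  have p3 : ∫ x in S, ∑ i, ∑ j, a x (i, j) * a x (j, i) =
        ∫ x in S, (∑ i, a x (i, i)) ^ 2 := by
    have : ∀ x, (∑ i, a x (i, i)) ^ 2 = ∑ i, ∑ j, a x (i, i) * a x (j, j) := fun x => by
      rw [sq, Finset.sum_mul_sum]
    simp only [this]
    rw [integral_finsetSum _ fun i _ => integrable_finsetSum _ fun j _ => hi (i, j) (j, i),
      integral_finsetSum _ fun i _ => integrable_finsetSum _ fun j _ => hi (i, i) (j, j)]
    refine Finset.sum_congr rfl fun i _ => ?_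
    rw [integral_finsetSum _ fun j _ => hi (i, j) (j, i),
      integral_finsetSum _ fun j _ => hi (i, i) (j, j)]
    exact Finset.sum_congr rfl fun j _ => hswap i j
  have p4 : 0 ≤ ∫ x in S, (∑ i, a x (i, i)) ^ 2 := integral_nonneg fun x => sq_nonneg _
  rw [e0, p2, p3]
  have := mul_nonneg hkG p1
  have := mul_nonneg hG.le p4
  linarith

theorem coercive_of_mem_testSub (hS : IsOpen S) {k G : ℝ} (hG : 0 < G)
    (hkG : 0 ≤ k - 2 / 3 * G) {U : H1 S} (hU : U ∈ testSub S) :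
    G * ‖grad U‖ ^ 2 ≤ inner ℝ ((elasticL N k G).compLp (grad U)) (grad U) := by
  obtain ⟨φ, hφ, hUφ⟩ := hU
  have hg := hφ.grad_ae_eq hS hUφ
  rw [inner_compLp_elasticL, norm_sq_Lp_coord]
  refine le_integral_contract_elasticPart (Lp.memLp _) (fun i j => ?_) hG hkG
  have e : ∀ q r, ∫ x in S, grad U x q * grad U x r =
      ∫ x in S, gradMat φ x q * gradMat φ x r := fun q r =>
    integral_congr_ae (by filter_upwards [hg] with x hx; rw [hx])
  rw [e, e, hφ.integral_gradMat_mul_swap hS]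

theorem poincare_of_mem_testSub (hS : IsOpen S) (i : Fin N) {R : ℝ} (hR : ∀ x ∈ S, |x i| ≤ R)
    {U : H1 S} (hU : U ∈ testSub S) : ‖val U‖ ^ 2 ≤ 4 * R ^ 2 * ‖grad U‖ ^ 2 := by
  obtain ⟨φ, hφ, hUφ⟩ := hU
  have hg := hφ.grad_ae_eq hS hUφ
  rw [norm_sq_Lp_coord, norm_sq_Lp_coord, Fintype.sum_prod_type]
  have e1 : ∀ j, ∫ x in S, val U x j ^ 2 = ∫ x in S, φ x j ^ 2 := fun j =>
    integral_congr_ae (by filter_upwards [hUφ] with x hx; rw [hx])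
  have e2 : ∀ j, ∫ x in S, grad U x (i, j) ^ 2 =
      ∫ x in S, fderiv ℝ (fun y => φ y j) x (e i) ^ 2 := fun j =>
    integral_congr_ae (by
      filter_upwards [hg] with x hx
      rw [hx, fderiv_coord (hφ.1.differentiable (by simp) x), gradMat_apply])
  calc ∑ j, ∫ x in S, val U x j ^ 2 ≤ ∑ j, 4 * R ^ 2 * ∫ x in S, grad U x (i, j) ^ 2 := by
        refine Finset.sum_le_sum fun j _ => ?_
        rw [e1, e2]
        exact (hφ.coord j).integral_sq_le hS i hR
    _ = 4 * R ^ 2 * ∑ j, ∫ x in S, grad U x (i, j) ^ 2 := by rw [Finset.mul_sum]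
    _ ≤ _ := by
        refine mul_le_mul_of_nonneg_left ?_ (by positivity)
        exact Finset.single_le_sum (f := fun i => ∑ j, ∫ x in S, grad U x (i, j) ^ 2)
          (fun i _ => Finset.sum_nonneg fun j _ => integral_nonneg fun x => sq_nonneg _)
          (Finset.mem_univ i)

/-- The elastic energy `(U, W) ↦ ∫ ε⁰(U) : ∇W` as a bounded bilinear form on `H¹(S)`. -/
def energyForm (S : Set (E N)) (k G : ℝ) : H1 S →L[ℝ] H1 S →L[ℝ] ℝ :=
  (isBoundedBilinearMap_inner (𝕜 := ℝ) (E := L2 S (Mat N))).toContinuousLinearMap.bilinearComp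
    (((elasticL N k G).compLpL 2 (volume.restrict S)).comp (gradL S)) (gradL S)

theorem energyForm_apply (k G : ℝ) (U W : H1 S) : energyForm S k G U W =
    inner ℝ ((elasticL N k G).compLp (grad U)) (grad W) := rfl

theorem energyForm_eq_integral (k G : ℝ) (U W : H1 S) : energyForm S k G U W =
    ∫ x in S, contract (elasticPart k G (grad U x)) (grad W x) :=
  inner_compLp_elasticL k G _ _

/-- The energy form is coercive on `H¹₀(S)`, by Korn's and Poincaré's inequalities. -/
theorem energyForm_coercive (hS : IsOpen S) (i : Fin N) {R : ℝ} (hR : ∀ x ∈ S, |x i| ≤ R)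
    {k G : ℝ} (hG : 0 < G) (hkG : 0 ≤ k - 2 / 3 * G) {U : H1 S} (hU : U ∈ H10sub S) :
    G * ‖U‖ ^ 2 ≤ (4 * R ^ 2 + 1) * energyForm S k G U U := by
  -- Both sides are continuous in the `H¹` norm, so the estimate only has to be checked on test
  -- fields.
  have hcl : IsClosed {U : H1 S | G * ‖U‖ ^ 2 ≤ (4 * R ^ 2 + 1) * energyForm S k G U U} :=
    isClosed_le (continuous_const.mul (continuous_norm.pow 2))
      (continuous_const.mul ((energyForm S k G).continuous.clm_apply continuous_id))
  refine closure_minimal (s := (testSub S : Set (H1 S))) ?_ hcl hU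
  intro W hW
  have h1 := coercive_of_mem_testSub hS hG hkG hW
  have h2 := poincare_of_mem_testSub hS i hR hW
  change G * ‖W‖ ^ 2 ≤ (4 * R ^ 2 + 1) * energyForm S k G W W
  rw [energyForm_apply, norm_sq_H1]
  have h3 : 0 ≤ 4 * R ^ 2 + 1 := by positivity
  calc G * (‖val W‖ ^ 2 + ‖grad W‖ ^ 2) ≤ (4 * R ^ 2 + 1) * (G * ‖grad W‖ ^ 2) := by nlinarith
    _ ≤ _ := mul_le_mul_of_nonneg_left h1 h3

theorem exists_energyForm_eq (hS : IsOpen S) (i : Fin N) {R : ℝ} (hR : ∀ x ∈ S, |x i| ≤ R)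
    {k G : ℝ} (hG : 0 < G) (hkG : 0 ≤ k - 2 / 3 * G) (F : H1 S →L[ℝ] ℝ) :
    ∃ V ∈ H10sub S, ∀ W ∈ H10sub S, energyForm S k G V W = F W := by
  have h3 : 0 < 4 * R ^ 2 + 1 := by positivity
  refine exists_bilin_eq_of_coercive (H10sub S) (energyForm S k G) (c := G / (4 * R ^ 2 + 1))
    (by positivity) (fun U hU => ?_) F
  exact div_mul_le_of_mul_le_mul h3 (energyForm_coercive hS i hR hG hkG hU)

theorem eq_of_energyForm_eq (hS : IsOpen S) (i : Fin N) {R : ℝ} (hR : ∀ x ∈ S, |x i| ≤ R)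
    {k G : ℝ} (hG : 0 < G) (hkG : 0 ≤ k - 2 / 3 * G) {U V : H1 S} (hU : U ∈ H10sub S)
    (hV : V ∈ H10sub S) (h : ∀ W ∈ H10sub S, energyForm S k G U W = energyForm S k G V W) :
    U = V := by
  have h3 : 0 < 4 * R ^ 2 + 1 := by positivity
  refine eq_of_bilin_eq_of_coercive (H10sub S) (energyForm S k G) (c := G / (4 * R ^ 2 + 1))
    (by positivity) (fun U hU => ?_) hU hV h
  exact div_mul_le_of_mul_le_mul h3 (energyForm_coercive hS i hR hG hkG hU)

end Inequalities

/-! ### A smooth substitute for truncation in two variables -/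

section Truncation

open scoped NNReal

/-- A smooth odd function that vanishes on `[-1, 1]` and is the identity away from `[-2, 2]`. -/
def smoothThreshold (s : ℝ) : ℝ := s * Real.smoothTransition (s ^ 2 - 1)

theorem contDiff_smoothThreshold : ContDiff ℝ ∞ smoothThreshold :=
  contDiff_id.mul (Real.smoothTransition.contDiff.comp ((contDiff_id.pow 2).sub contDiff_const))

theorem smoothThreshold_of_abs_le {s : ℝ} (hs : |s| ≤ 1) : smoothThreshold s = 0 := by
  have : s ^ 2 ≤ 1 := (sq_le_one_iff_abs_le_one s).2 hs
  rw [smoothThreshold, Real.smoothTransition.zero_of_nonpos (by linarith), mul_zero]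

theorem smoothThreshold_of_two_le {s : ℝ} (hs : 2 ≤ s ^ 2) : smoothThreshold s = s := by
  rw [smoothThreshold, Real.smoothTransition.one_of_one_le (by linarith), mul_one]

theorem abs_smoothThreshold_sub_le (s : ℝ) : |smoothThreshold s - s| ≤ 2 := by
  rcases le_or_gt 2 (s ^ 2) with h | h
  · simp [smoothThreshold_of_two_le h]
  · have h1 : |s| ≤ 2 := abs_le.2 ⟨by nlinarith, by nlinarith⟩
    have h2 := Real.smoothTransition.nonneg (s ^ 2 - 1)
    have h3 := Real.smoothTransition.le_one (s ^ 2 - 1)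
    have : smoothThreshold s - s = s * (Real.smoothTransition (s ^ 2 - 1) - 1) := by
      rw [smoothThreshold]; ring
    rw [this, abs_mul]
    have h4 : |Real.smoothTransition (s ^ 2 - 1) - 1| ≤ 1 := by
      rw [abs_le]; constructor <;> linarith
    nlinarith [abs_nonneg s, abs_nonneg (Real.smoothTransition (s ^ 2 - 1) - 1)]

/-- The function is the identity plus a smooth function of compact support. -/
theorem exists_lipschitzWith_smoothThreshold : ∃ L, LipschitzWith L smoothThreshold := by
  have hc : HasCompactSupport (fun s => smoothThreshold s - s) := by
    refine HasCompactSupport.intro (isCompact_Icc (a := (-2 : ℝ)) (b := 2)) fun s hs => ?_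
    rw [smoothThreshold_of_two_le, sub_self]
    rw [mem_Icc, ← abs_le, not_le] at hs
    nlinarith [sq_abs s]
  obtain ⟨L, hL⟩ := ContDiff.lipschitzWith_of_hasCompactSupport hc
    (contDiff_smoothThreshold.sub contDiff_id) (by simp)
  refine ⟨L + 1, ?_⟩
  simpa using hL.add LipschitzWith.id

/-- A smooth Lipschitz function that vanishes on both axes and is close to the identity on the
diagonal. -/
def smoothMean (p : ℝ × ℝ) : ℝ := 2 * p.1 ^ 2 * p.2 / (p.1 ^ 2 + p.2 ^ 2 + 1)

theorem contDiff_smoothMean : ContDiff ℝ ∞ smoothMean := by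
  refine ContDiff.div (by fun_prop) (by fun_prop) fun p => ?_
  positivity

/-- On the diagonal the defect is `a / (2a² + 1)`. -/
theorem abs_smoothMean_diag_sub_le (a : ℝ) : |smoothMean (a, a) - a| ≤ 1 := by
  have h : smoothMean (a, a) - a = -a / (a ^ 2 + a ^ 2 + 1) := by
    rw [smoothMean]; field_simp; ring
  rw [h, abs_div, abs_neg, abs_of_pos (by positivity : 0 < a ^ 2 + a ^ 2 + 1),
    div_le_one (by positivity)]
  nlinarith [sq_abs a, sq_nonneg (|a| - 1), abs_nonneg a]

/-- The difference quotient in each variable separately is at most `2` in absolute value; moving one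
variable at a time adds the two bounds. -/
theorem lipschitzWith_smoothMean : LipschitzWith 4 smoothMean := by
  refine LipschitzWith.of_dist_le_mul ?_
  rintro ⟨a, b⟩ ⟨a', b'⟩
  have h1 : |smoothMean (a, b) - smoothMean (a', b)| ≤ 2 * |a - a'| := by
    have : smoothMean (a, b) - smoothMean (a', b) = (a - a') *
        (2 * (b * (a + a') * (b ^ 2 + 1)) /
          ((a ^ 2 + b ^ 2 + 1) * (a' ^ 2 + b ^ 2 + 1))) := by
      simp only [smoothMean]; field_simp; ring
    rw [this, abs_mul, mul_comm]
    refine mul_le_mul_of_nonneg_right ?_ (abs_nonneg _)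
    rw [abs_div, abs_of_pos (by positivity : 0 < (a ^ 2 + b ^ 2 + 1) * (a' ^ 2 + b ^ 2 + 1)),
      div_le_iff₀ (by positivity), abs_mul, abs_two]
    refine mul_le_mul_of_nonneg_left ?_ (zero_le_two (α := ℝ))
    have k1 : |b * a| ≤ (a ^ 2 + b ^ 2 + 1) / 2 := by
      rw [abs_le]; constructor <;> nlinarith [sq_nonneg (a - b), sq_nonneg (a + b)]
    have k2 : |b * a'| ≤ (a' ^ 2 + b ^ 2 + 1) / 2 := by
      rw [abs_le]; constructor <;> nlinarith [sq_nonneg (a' - b), sq_nonneg (a' + b)]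
    have k3 : |b * (a + a') * (b ^ 2 + 1)| ≤ (|b * a| + |b * a'|) * (b ^ 2 + 1) := by
      have hb : 0 < b ^ 2 + 1 := by positivity
      rw [abs_mul, abs_of_pos hb, mul_add b a]
      exact mul_le_mul_of_nonneg_right (abs_add_le _ _) hb.le
    refine k3.trans ?_
    have k4 : |b * a| * (b ^ 2 + 1) ≤ (a ^ 2 + b ^ 2 + 1) / 2 * (a' ^ 2 + b ^ 2 + 1) :=
      mul_le_mul k1 (by nlinarith [sq_nonneg a']) (by positivity) (by positivity)
    have k5 : |b * a'| * (b ^ 2 + 1) ≤ (a' ^ 2 + b ^ 2 + 1) / 2 * (a ^ 2 + b ^ 2 + 1) :=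
      mul_le_mul k2 (by nlinarith [sq_nonneg a]) (by positivity) (by positivity)
    linarith
  have h2 : |smoothMean (a', b) - smoothMean (a', b')| ≤ 2 * |b - b'| := by
    have : smoothMean (a', b) - smoothMean (a', b') = (b - b') *
        (2 * (a' ^ 2 * (a' ^ 2 + 1 - b * b')) /
          ((a' ^ 2 + b ^ 2 + 1) * (a' ^ 2 + b' ^ 2 + 1))) := by
      simp only [smoothMean]; field_simp; ring
    rw [this, abs_mul, mul_comm]
    refine mul_le_mul_of_nonneg_right ?_ (abs_nonneg _)
    rw [abs_div, abs_of_pos (by positivity : 0 < (a' ^ 2 + b ^ 2 + 1) * (a' ^ 2 + b' ^ 2 + 1)),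
      div_le_iff₀ (by positivity), abs_mul, abs_two]
    refine mul_le_mul_of_nonneg_left ?_ (zero_le_two (α := ℝ))
    have k1 : |b * b'| ≤ (b ^ 2 + b' ^ 2) / 2 := by
      rw [abs_le]; constructor <;> nlinarith [sq_nonneg (b - b'), sq_nonneg (b + b')]
    have k2 : |a' ^ 2 + 1 - b * b'| ≤ a' ^ 2 + 1 + (b ^ 2 + b' ^ 2) / 2 := by
      rw [abs_le] at k1 ⊢
      constructor <;> nlinarith [sq_nonneg a', k1.1, k1.2]
    rw [abs_mul, abs_of_nonneg (sq_nonneg a')]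
    calc a' ^ 2 * |a' ^ 2 + 1 - b * b'| ≤ a' ^ 2 * (a' ^ 2 + 1 + (b ^ 2 + b' ^ 2) / 2) :=
          mul_le_mul_of_nonneg_left k2 (sq_nonneg _)
      _ ≤ _ := by nlinarith [mul_nonneg (sq_nonneg a') (sq_nonneg b),
            mul_nonneg (sq_nonneg a') (sq_nonneg b'), mul_nonneg (sq_nonneg b) (sq_nonneg b'),
            sq_nonneg a', sq_nonneg b, sq_nonneg b']
  have d1 : |a - a'| ≤ dist (a, b) (a', b') := le_max_left (dist a a') (dist b b')
  have d2 : |b - b'| ≤ dist (a, b) (a', b') := le_max_right (dist a a') (dist b b')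
  rw [Real.dist_eq]
  have := abs_sub_le (smoothMean (a, b)) (smoothMean (a', b)) (smoothMean (a', b'))
  push_cast
  linarith

/-- Smooth functions of two variables, with a common Lipschitz constant, that vanish near the axes
and are close to the identity on the diagonal. -/
theorem exists_smooth_truncation : ∃ L : ℝ≥0, ∀ ε : ℝ, 0 < ε → ∃ Φ : ℝ × ℝ → ℝ,
    ContDiff ℝ ∞ Φ ∧ LipschitzWith L Φ ∧ (∀ p : ℝ × ℝ, |p.1| ≤ ε ∨ |p.2| ≤ ε → Φ p = 0) ∧
      ∀ u, |Φ (u, u) - u| ≤ 3 * ε := by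
  obtain ⟨L, hL⟩ := exists_lipschitzWith_smoothThreshold
  refine ⟨4 * L, fun ε hε => ⟨fun p => ε * smoothMean (smoothThreshold (p.1 / ε),
    smoothThreshold (p.2 / ε)), ?_, ?_, ?_, ?_⟩⟩
  · exact contDiff_const.mul (contDiff_smoothMean.comp
      ((contDiff_smoothThreshold.comp (contDiff_fst.div_const ε)).prodMk
        (contDiff_smoothThreshold.comp (contDiff_snd.div_const ε))))
  · refine LipschitzWith.of_dist_le_mul fun p q => ?_
    have h1 := lipschitzWith_smoothMean.dist_le_mul
      (smoothThreshold (p.1 / ε), smoothThreshold (p.2 / ε))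
      (smoothThreshold (q.1 / ε), smoothThreshold (q.2 / ε))
    have h2 : dist (smoothThreshold (p.1 / ε), smoothThreshold (p.2 / ε))
      (smoothThreshold (q.1 / ε), smoothThreshold (q.2 / ε)) ≤ L * (dist p q / ε) := by
      have key : ∀ s t : ℝ, dist s t ≤ dist p q →
          dist (smoothThreshold (s / ε)) (smoothThreshold (t / ε)) ≤ L * (dist p q / ε) := by
        intro s t hst
        refine (hL.dist_le_mul _ _).trans (mul_le_mul_of_nonneg_left ?_ L.2)
        rw [Real.dist_eq, ← sub_div, abs_div, abs_of_pos hε]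
        exact div_le_div_of_nonneg_right hst hε.le
      exact max_le (key _ _ (le_max_left _ _)) (key _ _ (le_max_right _ _))
    rw [Real.dist_eq] at h1 ⊢
    rw [← mul_sub, abs_mul, abs_of_pos hε]
    push_cast at h1 ⊢
    calc ε * |_| ≤ ε * (4 * (L * (dist p q / ε))) :=
          mul_le_mul_of_nonneg_left (h1.trans (by linarith)) hε.le
      _ = 4 * L * dist p q := by field_simp
  · have h0 : ∀ s, |s| ≤ ε → smoothThreshold (s / ε) = 0 := fun s hs =>
      smoothThreshold_of_abs_le (by rw [abs_div, abs_of_pos hε, div_le_one hε]; exact hs)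
    rintro p (h | h)
    · simp [h0 _ h, smoothMean]
    · simp [h0 _ h, smoothMean]
  · intro u
    have h1 := abs_smoothMean_diag_sub_le (smoothThreshold (u / ε))
    have h2 := abs_smoothThreshold_sub_le (u / ε)
    have h3 : ε * smoothMean (smoothThreshold (u / ε), smoothThreshold (u / ε)) - u =
        ε * (smoothMean (smoothThreshold (u / ε), smoothThreshold (u / ε)) - u / ε) := by
      field_simp
    simp only [h3, abs_mul, abs_of_pos hε]
    rw [mul_comm 3 ε]
    refine mul_le_mul_of_nonneg_left ?_ hε.le
    have := abs_sub_le (smoothMean (smoothThreshold (u / ε), smoothThreshold (u / ε)))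
      (smoothThreshold (u / ε)) (u / ε)
    linarith

end Truncation

/-! ### Mollification of functions and of weak derivatives -/

section Mollification

open scoped Convolution

variable {N : ℕ} {S : Set (E N)}

/-- The mollification of `f` by a bump function. -/
def moll (ρ : ContDiffBump (0 : E N)) (f : E N → ℝ) : E N → ℝ :=
  f ⋆[ContinuousLinearMap.lsmul ℝ ℝ, volume] ρ.normed volume

theorem moll_apply (ρ : ContDiffBump (0 : E N)) (f : E N → ℝ) (x : E N) :
    moll ρ f x = ∫ t, f t * ρ.normed volume (x - t) := rfl

theorem contDiff_moll (ρ : ContDiffBump (0 : E N)) {f : E N → ℝ} (hf : LocallyIntegrable f) :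
    ContDiff ℝ ∞ (moll ρ f) :=
  ρ.hasCompactSupport_normed.contDiff_convolution_right _ hf ρ.contDiff_normed

theorem fderiv_moll (ρ : ContDiffBump (0 : E N)) {f : E N → ℝ} (hf : LocallyIntegrable f)
    (x v : E N) :
    fderiv ℝ (moll ρ f) x v = ∫ t, f t * fderiv ℝ (ρ.normed volume) (x - t) v := by
  have h := ρ.hasCompactSupport_normed (μ := volume) |>.hasFDerivAt_convolution_right
    (ContinuousLinearMap.lsmul ℝ ℝ) hf (ρ.contDiff_normed (n := 1)) x
  rw [moll, h.fderiv, convolution_precompR_apply _ hf (ρ.hasCompactSupport_normed.fderiv ℝ)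
    (ρ.contDiff_normed.continuous_fderiv (n := 1) one_ne_zero)]
  rfl

theorem abs_moll_sub_le (ρ : ContDiffBump (0 : E N)) {f : E N → ℝ} (hf : AEStronglyMeasurable f)
    {x : E N} {ε : ℝ} (h : ∀ y ∈ Metric.ball x ρ.rOut, |f y - f x| ≤ ε) :
    |moll ρ f x - f x| ≤ ε := by
  have h1 := ρ.dist_normed_convolution_le (μ := volume) hf h
  rw [convolution_lsmul_swap] at h1
  rw [moll_apply, ← Real.dist_eq]
  simpa [mul_comm] using h1

theorem integrable_moll (ρ : ContDiffBump (0 : E N)) {g : E N → ℝ} (hg : Integrable g) :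
    Integrable (moll ρ g) :=
  hg.integrable_convolution _ ρ.integrable_normed

theorem integral_moll (ρ : ContDiffBump (0 : E N)) {g : E N → ℝ} (hg : Integrable g) :
    ∫ x, moll ρ g x = ∫ x, g x := by
  rw [moll, integral_convolution _ hg ρ.integrable_normed, ρ.integral_normed]
  simp

/-- Jensen's inequality for mollification. -/
theorem sq_moll_le (ρ : ContDiffBump (0 : E N)) {g : E N → ℝ} (hg : MemLp g 2) (x : E N) :
    moll ρ g x ^ 2 ≤ moll ρ (fun y => g y ^ 2) x := by
  set r : E N → ℝ := fun t => ρ.normed volume (x - t) with hr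
  have hrc : Continuous r := ρ.contDiff_normed.continuous (n := 0) |>.comp (by fun_prop)
  have hri : Integrable r := ρ.integrable_normed.comp_sub_left x
  have hr1 : ∫ t, r t = 1 := by
    rw [hr, integral_sub_left_eq_self (ρ.normed volume) volume x, ρ.integral_normed]
  have hrs : HasCompactSupport r :=
    ρ.hasCompactSupport_normed.comp_homeomorph (Homeomorph.subLeft x)
  have i1 : Integrable (fun t => g t * r t) :=
    hg.integrable_mul (hrc.memLp_of_hasCompactSupport (p := 2) hrs)
  have i2 : Integrable (fun t => g t ^ 2 * r t) := by
    obtain ⟨C, hC⟩ := hrs.exists_bound_of_continuous hrc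
    exact hg.integrable_sq.mul_bdd (c := C) hrc.aestronglyMeasurable (Eventually.of_forall hC)
  rw [moll_apply, moll_apply]
  set m := ∫ t, g t * r t with hm
  -- The variance `∫ (g - m)² r` for the probability density `r`, expanded.
  have h0 : 0 ≤ ∫ t, (g t ^ 2 * r t - (2 * m * (g t * r t) - m ^ 2 * r t)) := by
    refine integral_nonneg fun t => ?_
    have : 0 ≤ (g t - m) ^ 2 * r t := mul_nonneg (sq_nonneg _) (ρ.nonneg_normed _)
    change 0 ≤ _
    nlinarith
  have i3 : Integrable (fun t => 2 * m * (g t * r t) - m ^ 2 * r t) :=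
    (i1.const_mul _).sub (hri.const_mul _)
  rw [integral_sub i2 i3, integral_sub (i1.const_mul _) (hri.const_mul _), integral_const_mul, integral_const_mul,
    hr1, ← hm] at h0
  change m ^ 2 ≤ ∫ t, g t ^ 2 * r t
  nlinarith

theorem moll_nonneg (ρ : ContDiffBump (0 : E N)) {g : E N → ℝ} (hg : ∀ x, 0 ≤ g x) (x : E N) :
    0 ≤ moll ρ g x := by
  rw [moll_apply]
  exact integral_nonneg fun t => mul_nonneg (hg t) (ρ.nonneg_normed _)

/-- The mollification of a weak derivative is the derivative of the mollification. -/
theorem fderiv_moll_indicator (hS : IsOpen S) (ρ : ContDiffBump (0 : E N)) {f g : E N → ℝ}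
    {v : E N} (hf : MemLp f 2 (volume.restrict S))
    (h : ∀ φ : E N → ℝ, IsTest S φ →
      ∫ x in S, f x * fderiv ℝ φ x v = - ∫ x in S, g x * φ x)
    {x : E N} (hx : Metric.closedBall x ρ.rOut ⊆ S) :
    fderiv ℝ (moll ρ (S.indicator f)) x v = moll ρ (S.indicator g) x := by
  have hfl : LocallyIntegrable (S.indicator f) :=
    ((memLp_indicator_iff_restrict hS.measurableSet).2 hf).locallyIntegrable (by norm_num)
  have hd : ∀ t, fderiv ℝ (fun y => ρ.normed volume (x - y)) t v =
      - fderiv ℝ (ρ.normed volume) (x - t) v := by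
    intro t
    have h1 : HasFDerivAt (ρ.normed volume) (fderiv ℝ (ρ.normed volume) (x - t)) (x - t) :=
      (ρ.contDiff_normed.differentiable (n := 1) one_ne_zero _).hasFDerivAt
    have h2 : HasFDerivAt (fun y => ρ.normed volume (x - y)) _ t :=
      h1.comp t ((hasFDerivAt_id t).const_sub x)
    rw [h2.fderiv]
    simp
  -- The reflected kernel centred at `x` is an admissible test function because its support lies in
  -- a ball contained in `S`.
  have ht : IsTest S (fun y => ρ.normed volume (x - y)) := by
    have hcs : tsupport (fun y => ρ.normed volume (x - y)) ⊆ Metric.closedBall x ρ.rOut := by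
      refine closure_minimal (fun y hy => ?_) Metric.isClosed_closedBall
      have : x - y ∈ Function.support (ρ.normed volume) := hy
      rw [ρ.support_normed_eq, Metric.mem_ball, dist_zero_right, ← dist_eq_norm, dist_comm] at this
      exact this.le
    exact ⟨ρ.contDiff_normed.comp (contDiff_const.sub contDiff_id),
      (isCompact_closedBall x ρ.rOut).of_isClosed_subset (isClosed_tsupport _) hcs, hcs.trans hx⟩
  have h1 := h _ ht
  rw [fderiv_moll ρ hfl, moll_apply]
  have e1 : ∀ a b : E N → ℝ, ∫ t, S.indicator a t * b t = ∫ t in S, a t * b t := by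
    intro a b
    rw [← integral_indicator hS.measurableSet]
    congr 1
    funext t
    by_cases ht : t ∈ S <;> simp [ht]
  rw [e1, e1]
  simp only [hd, mul_neg, integral_neg] at h1
  linarith

end Mollification

/-! ### Test functions from a pair of functions vanishing on complementary boundary parts -/

section Approximation

open scoped NNReal

variable {N : ℕ} {S : Set (E N)}

theorem IsTest.of_eventually_zero {U K : Set (E N)} (hU : IsOpen U) (hK : IsCompact K)
    (hKU : K ⊆ U) (hKS : K ⊆ S) {ψ : E N → ℝ} (hψU : ContDiffOn ℝ ∞ ψ U)
    (hψK : ∀ x ∉ K, ψ x = 0) : IsTest S ψ := by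
  have hsub : tsupport ψ ⊆ K :=
    closure_minimal (fun x hx => by_contra fun h => hx (hψK x h)) hK.isClosed
  refine ⟨contDiff_iff_contDiffAt.2 fun x => ?_,
    hK.of_isClosed_subset (isClosed_tsupport _) hsub, hsub.trans hKS⟩
  by_cases hx : x ∈ K
  · exact hψU.contDiffAt (hU.mem_nhds (hKU hx))
  · refine (contDiffAt_const (c := (0 : ℝ))).congr_of_eventuallyEq ?_
    filter_upwards [hK.isClosed.isOpen_compl.mem_nhds hx] with y hy
    exact hψK y hy

/-- Composing mollifications of `f` and `g` with a truncation that vanishes near the axes gives a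
test function, if one of `f` and `g` vanishes at every boundary point. -/
theorem exists_isTest_near (hS : IsOpen S) (hb : Bornology.IsBounded S) {ε : ℝ} (hε : 0 < ε)
    {L : ℝ≥0} {Φ : ℝ × ℝ → ℝ} (hΦ : ContDiff ℝ ∞ Φ) (hL : LipschitzWith L Φ)
    (hΦ0 : ∀ p : ℝ × ℝ, |p.1| ≤ ε ∨ |p.2| ≤ ε → Φ p = 0)
    {f g : E N → ℝ} (hf : ContinuousOn f (closure S)) (hg : ContinuousOn g (closure S))
    (hfg : ∀ x ∈ frontier S, f x = 0 ∨ g x = 0) {ι : Type} {v : ι → E N} {F G : ι → E N → ℝ}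
    (hF2 : ∀ i, MemLp (F i) 2 (volume.restrict S)) (hG2 : ∀ i, MemLp (G i) 2 (volume.restrict S))
    (hF : ∀ φ : E N → ℝ, IsTest S φ → ∀ i,
      ∫ x in S, f x * fderiv ℝ φ x (v i) = - ∫ x in S, F i x * φ x)
    (hG : ∀ φ : E N → ℝ, IsTest S φ → ∀ i,
      ∫ x in S, g x * fderiv ℝ φ x (v i) = - ∫ x in S, G i x * φ x) :
    ∃ ψ : E N → ℝ, IsTest S ψ ∧ (∀ x ∈ S, |ψ x - Φ (f x, g x)| ≤ ε) ∧
      ∀ i, ∫ x in S, fderiv ℝ ψ x (v i) ^ 2 ≤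
        L ^ 2 * ((∫ x in S, F i x ^ 2) + ∫ x in S, G i x ^ 2) := by
  have hcS : IsCompact (closure S) := hb.isCompact_closure
  -- The set where neither function is small. It is compact and avoids `∂S`, where one of the two
  -- vanishes.
  set K : Set (E N) := closure S ∩ ((fun x => |f x|) ⁻¹' Ici (ε / 2)) ∩
    (closure S ∩ (fun x => |g x|) ⁻¹' Ici (ε / 2))
  have hK : IsCompact K :=
    hcS.of_isClosed_subset ((hf.abs.preimage_isClosed_of_isClosed isClosed_closure isClosed_Ici).inter
      (hg.abs.preimage_isClosed_of_isClosed isClosed_closure isClosed_Ici))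
      (fun x hx => hx.1.1)
  have hKS : K ⊆ S := by
    intro x hx
    by_contra hxS
    have hfr : x ∈ frontier S := by
      rw [frontier, hS.interior_eq]
      exact ⟨hx.1.1, hxS⟩
    have h1 : ε / 2 ≤ |f x| := hx.1.2
    have h2 : ε / 2 ≤ |g x| := hx.2.2
    rcases hfg x hfr with h | h
    · rw [h, abs_zero] at h1; linarith
    · rw [h, abs_zero] at h2; linarith
  obtain ⟨δ, hδ, hδS⟩ := hK.exists_cthickening_subset_open hS hKS
  -- The bound `ε / 2` keeps a mollified value below `ε` wherever the original is below `ε / 2`. The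
  -- bound `ε / (L + 1)` makes the resulting error in `Φ` at most `ε`, also when `L = 0`.
  have hε1 : 0 < min (ε / 2) (ε / (L + 1)) := by positivity
  set ε₁ := min (ε / 2) (ε / (L + 1))
  obtain ⟨r₁, hr₁, hfr⟩ := Metric.uniformContinuousOn_iff.1
    (hcS.uniformContinuousOn_of_continuous hf) ε₁ hε1
  obtain ⟨r₂, hr₂, hgr⟩ := Metric.uniformContinuousOn_iff.1
    (hcS.uniformContinuousOn_of_continuous hg) ε₁ hε1
  -- Radius `δ / 2` keeps balls centred in the `δ / 2`-neighbourhood `U` of `K` inside `S`; `r₁` and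
  -- `r₂` come from uniform continuity.
  have hr : 0 < min (δ / 2) (min r₁ r₂) := by positivity
  set r := min (δ / 2) (min r₁ r₂)
  let ρ : ContDiffBump (0 : E N) := ⟨r / 2, r, by positivity, by linarith⟩
  set U := Metric.thickening (δ / 2) K
  have hUball : ∀ x ∈ U, Metric.closedBall x r ⊆ S := by
    intro x hx y hy
    obtain ⟨z, hz, hxz⟩ := Metric.mem_thickening_iff.1 hx
    refine hδS (Metric.mem_cthickening_of_dist_le y z δ K hz ?_)
    have h1 : dist y x ≤ r := hy
    have h2 : r ≤ δ / 2 := min_le_left _ _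
    linarith [dist_triangle y x z]
  have hUS : U ⊆ S := fun x hx => hUball x hx (Metric.mem_closedBall_self hr.le)
  have hKU : K ⊆ U := Metric.self_subset_thickening (by positivity) K
  have hmS := hS.measurableSet
  have hmem : ∀ {u : E N → ℝ}, ContinuousOn u (closure S) → MemLp u 2 (volume.restrict S) := by
    intro u hu
    obtain ⟨C, hC⟩ := hcS.exists_bound_of_continuousOn hu
    have : IsFiniteMeasure (volume.restrict S) := ⟨by
      rw [Measure.restrict_apply_univ]; exact hb.measure_lt_top⟩
    refine MemLp.of_bound ((hu.mono subset_closure).aestronglyMeasurable hmS) C ?_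
    exact (ae_restrict_iff' hmS).2 (Eventually.of_forall fun x hx => hC x (subset_closure hx))
  have hind : ∀ {u : E N → ℝ}, MemLp u 2 (volume.restrict S) → MemLp (S.indicator u) 2 volume :=
    fun hu => (memLp_indicator_iff_restrict hmS).2 hu
  have hloc : ∀ {u : E N → ℝ}, MemLp u 2 (volume.restrict S) →
      LocallyIntegrable (S.indicator u) := fun hu => (hind hu).locallyIntegrable (by norm_num)
  set fk := moll ρ (S.indicator f)
  set gk := moll ρ (S.indicator g)
  have near : ∀ {u : E N → ℝ}, ContinuousOn u (closure S) →
      (∀ x ∈ closure S, ∀ y ∈ closure S, dist x y < r → dist (u x) (u y) < ε₁) →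
      ∀ x ∈ U, |moll ρ (S.indicator u) x - u x| ≤ ε₁ := by
    intro u hu hur x hx
    have hxS := hUS hx
    have h1 := abs_moll_sub_le ρ (hind (hmem hu)).aestronglyMeasurable (x := x) (ε := ε₁)
      (fun y hy => by
        have hyS : y ∈ S := hUball x hx (Metric.ball_subset_closedBall hy)
        rw [indicator_of_mem hyS, indicator_of_mem hxS, ← Real.dist_eq]
        exact (hur y (subset_closure hyS) x (subset_closure hxS) hy).le)
    rwa [indicator_of_mem hxS] at h1
  have nf : ∀ x ∈ U, |fk x - f x| ≤ ε₁ := near hf fun x hx y hy h =>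
    hfr x hx y hy (h.trans_le ((min_le_right _ _).trans (min_le_left _ _)))
  have ng : ∀ x ∈ U, |gk x - g x| ≤ ε₁ := near hg fun x hx y hy h =>
    hgr x hx y hy (h.trans_le ((min_le_right _ _).trans (min_le_right _ _)))
  have hsm : ContDiff ℝ ∞ (fun x => Φ (fk x, gk x)) :=
    hΦ.comp ((contDiff_moll ρ (hloc (hmem hf))).prodMk (contDiff_moll ρ (hloc (hmem hg))))
  have hout : ∀ x ∈ S, x ∉ K → |f x| < ε / 2 ∨ |g x| < ε / 2 := by
    intro x hx hxK
    by_contra! h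
    exact hxK ⟨⟨subset_closure hx, h.1⟩, ⟨subset_closure hx, h.2⟩⟩
  -- The composition already vanishes on `U` outside `K`, so cutting it off outside `U` creates no
  -- singularity.
  have hψ0 : ∀ x ∉ K, U.indicator (fun x => Φ (fk x, gk x)) x = 0 := by
    intro x hxK
    by_cases hx : x ∈ U
    · rw [indicator_of_mem hx]
      have h2 : ε₁ ≤ ε / 2 := min_le_left _ _
      refine hΦ0 _ ((hout x (hUS hx) hxK).imp (fun h => ?_) (fun h => ?_))
      · have := abs_sub_abs_le_abs_sub (fk x) (f x)
        have := nf x hx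
        simp only
        linarith
      · have := abs_sub_abs_le_abs_sub (gk x) (g x)
        have := ng x hx
        simp only
        linarith
    · rw [indicator_of_notMem hx]
  have htest : IsTest S (U.indicator fun x => Φ (fk x, gk x)) :=
    IsTest.of_eventually_zero Metric.isOpen_thickening hK hKU hKS
      (hsm.contDiffOn.congr fun x hx => indicator_of_mem hx _) hψ0
  refine ⟨_, htest, fun x hx => ?_, fun i => ?_⟩
  · by_cases hxU : x ∈ U
    · rw [indicator_of_mem hxU, ← Real.dist_eq]
      refine (hL.dist_le_mul _ _).trans ?_
      have h1 : dist (fk x, gk x) (f x, g x) ≤ ε₁ := max_le (nf x hxU) (ng x hxU)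
      have h2 : ε₁ ≤ ε / (L + 1) := min_le_right _ _
      have h3 : (0 : ℝ) < L + 1 := by positivity
      calc (L : ℝ) * dist (fk x, gk x) (f x, g x) ≤ (L + 1) * (ε / (L + 1)) :=
            mul_le_mul (by linarith) (h1.trans h2) dist_nonneg h3.le
        _ = ε := by field_simp
    · have : Φ (f x, g x) = 0 :=
        hΦ0 _ ((hout x hx fun h => hxU (hKU h)).imp (fun h => by simp only; linarith)
          (fun h => by simp only; linarith))
      rw [indicator_of_notMem hxU, this, sub_zero, abs_zero]
      exact hε.le
  · have hFi := hind (hF2 i)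
    have hGi := hind (hG2 i)
    -- On `U` this is the chain rule, with `‖DΦ‖ ≤ L` for the sup norm on `ℝ × ℝ`, followed by
    -- Jensen's inequality. Since mollification preserves integrals, integrating the bound adds no
    -- further constant.
    have pt : ∀ x, fderiv ℝ (U.indicator fun x => Φ (fk x, gk x)) x (v i) ^ 2 ≤
        L ^ 2 * (moll ρ (fun y => S.indicator (F i) y ^ 2) x
          + moll ρ (fun y => S.indicator (G i) y ^ 2) x) := by
      intro x
      have n1 := moll_nonneg ρ (fun y => sq_nonneg (S.indicator (F i) y)) x
      have n2 := moll_nonneg ρ (fun y => sq_nonneg (S.indicator (G i) y)) x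
      by_cases hx : x ∈ U
      · have he : (U.indicator fun x => Φ (fk x, gk x)) =ᶠ[𝓝 x] fun x => Φ (fk x, gk x) := by
          filter_upwards [Metric.isOpen_thickening.mem_nhds hx] with y hy
          exact indicator_of_mem hy _
        have d1 : HasFDerivAt fk (fderiv ℝ fk x) x :=
          ((contDiff_moll ρ (hloc (hmem hf))).differentiable (by simp) x).hasFDerivAt
        have d2 : HasFDerivAt gk (fderiv ℝ gk x) x :=
          ((contDiff_moll ρ (hloc (hmem hg))).differentiable (by simp) x).hasFDerivAt
        have d3 : HasFDerivAt Φ (fderiv ℝ Φ (fk x, gk x)) (fk x, gk x) :=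
          (hΦ.differentiable (by simp) _).hasFDerivAt
        have d4 : HasFDerivAt (fun x => Φ (fk x, gk x)) _ x :=
          d3.comp x (d1.prodMk d2)
        have s1 : fderiv ℝ fk x (v i) = moll ρ (S.indicator (F i)) x :=
          fderiv_moll_indicator hS ρ (hmem hf) (fun φ hφ => hF φ hφ i) (hUball x hx)
        have s2 : fderiv ℝ gk x (v i) = moll ρ (S.indicator (G i)) x :=
          fderiv_moll_indicator hS ρ (hmem hg) (fun φ hφ => hG φ hφ i) (hUball x hx)
        rw [he.fderiv_eq, d4.fderiv]
        simp only [ContinuousLinearMap.comp_apply, ContinuousLinearMap.prod_apply, s1, s2]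
        have b1 := (fderiv ℝ Φ (fk x, gk x)).le_of_opNorm_le (norm_fderiv_le_of_lipschitz ℝ hL)
          (moll ρ (S.indicator (F i)) x, moll ρ (S.indicator (G i)) x)
        rw [Real.norm_eq_abs] at b1
        have b2 := pow_le_pow_left₀ (abs_nonneg _) b1 2
        rw [sq_abs, mul_pow] at b2
        refine b2.trans (mul_le_mul_of_nonneg_left ?_ (sq_nonneg _))
        have j1 := sq_moll_le ρ hFi x
        have j2 := sq_moll_le ρ hGi x
        rw [Prod.norm_mk]
        rcases max_choice ‖moll ρ (S.indicator (F i)) x‖ ‖moll ρ (S.indicator (G i)) x‖ with h | h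
        · rw [h, Real.norm_eq_abs, sq_abs]; linarith
        · rw [h, Real.norm_eq_abs, sq_abs]; linarith
      · have he : (U.indicator fun x => Φ (fk x, gk x)) =ᶠ[𝓝 x] fun _ => 0 := by
          filter_upwards [hK.isClosed.isOpen_compl.mem_nhds fun h => hx (hKU h)] with y hy
          exact hψ0 y hy
        rw [he.fderiv_eq]
        simp only [fderiv_fun_const, Pi.zero_apply, zero_apply]
        rw [zero_pow two_ne_zero]
        exact mul_nonneg (sq_nonneg _) (add_nonneg n1 n2)
    have iF := integrable_moll ρ hFi.integrable_sq
    have iG := integrable_moll ρ hGi.integrable_sq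
    have eq : ∀ u : E N → ℝ, ∫ x, S.indicator u x ^ 2 = ∫ x in S, u x ^ 2 := by
      intro u
      rw [← integral_indicator hmS]
      congr 1
      funext x
      by_cases hx : x ∈ S <;> simp [hx]
    have iψ : Integrable fun x =>
        fderiv ℝ (U.indicator fun x => Φ (fk x, gk x)) x (v i) ^ 2 := by
      have hc : Continuous fun x => fderiv ℝ (U.indicator fun x => Φ (fk x, gk x)) x (v i) :=
        (htest.1.continuous_fderiv (by simp)).clm_apply continuous_const
      exact (hc.memLp_of_hasCompactSupport (p := 2) (htest.2.1.fderiv_apply ℝ (v i))).integrable_sq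
    calc ∫ x in S, fderiv ℝ (U.indicator fun x => Φ (fk x, gk x)) x (v i) ^ 2
        ≤ ∫ x, fderiv ℝ (U.indicator fun x => Φ (fk x, gk x)) x (v i) ^ 2 :=
          setIntegral_le_integral iψ (Eventually.of_forall fun x => sq_nonneg _)
      _ ≤ ∫ x, L ^ 2 * (moll ρ (fun y => S.indicator (F i) y ^ 2) x
          + moll ρ (fun y => S.indicator (G i) y ^ 2) x) :=
          integral_mono iψ ((iF.add iG).const_mul _) pt
      _ = _ := by
          rw [integral_const_mul, integral_add iF iG, integral_moll ρ hFi.integrable_sq,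
            integral_moll ρ hGi.integrable_sq, eq, eq]

end Approximation

/-! ### Boundary values in the sense of `H¹` and membership in `H¹₀(S)` -/

section BoundaryValues

open scoped NNReal

variable {N : ℕ} {S : Set (E N)}

theorem IsTest.of_coord {φ : E N → E N} (h : ∀ j, IsTest S (fun x => φ x j)) : IsTest S φ := by
  have hK : IsCompact (⋃ j, tsupport fun x => φ x j) := isCompact_iUnion fun j => (h j).2.1
  have hsub : tsupport φ ⊆ ⋃ j, tsupport fun x => φ x j := by
    refine closure_minimal (fun x hx => ?_) hK.isClosed
    by_contra hx'
    simp only [mem_iUnion, not_exists] at hx'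
    exact hx (by ext j; exact image_eq_zero_of_notMem_tsupport (f := fun x => φ x j) (hx' j))
  exact ⟨contDiff_euclidean.2 fun j => (h j).1, hK.of_isClosed_subset (isClosed_tsupport _) hsub,
    hsub.trans (iUnion_subset fun j => (h j).2.2)⟩

theorem norm_le_sum_abs (x : E N) : ‖x‖ ≤ ∑ j, |x j| := by
  rw [EuclideanSpace.norm_eq]
  refine Real.sqrt_le_iff.2 ⟨Finset.sum_nonneg fun j _ => abs_nonneg _, ?_⟩
  simpa using Finset.sum_sq_le_sq_sum_of_nonneg (s := Finset.univ) (f := fun j => |x j|)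
    fun j _ => abs_nonneg _

/-- `L` and `C` do not depend on `ε` or on the fields. If `U` and `W` are both close to `V` in `L²`,
so is `w`, because `Φ(V, V)` is nearly `V` componentwise; the gradient of `w` is merely bounded. -/
theorem exists_mem_testSub_near (hS : IsOpen S) (hb : Bornology.IsBounded S) :
    ∃ L C : ℝ, 0 ≤ C ∧ ∀ ε : ℝ, 0 < ε → ∀ (U W V : H1 S) (f g : E N → E N),
      ContinuousOn f (closure S) → ContinuousOn g (closure S) → val U =ᵐ[volume.restrict S] f →
      val W =ᵐ[volume.restrict S] g → (∀ x ∈ frontier S, f x = 0 ∨ g x = 0) →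
      ∃ w ∈ testSub S, ‖grad w‖ ^ 2 ≤ L ^ 2 * (‖grad U‖ ^ 2 + ‖grad W‖ ^ 2) ∧
        ‖val w - val V‖ ^ 2 ≤ C * (ε ^ 2 + ‖val U - val V‖ ^ 2 + ‖val W - val V‖ ^ 2) := by
  obtain ⟨L, hLΦ⟩ := exists_smooth_truncation
  have : IsFiniteMeasure (volume.restrict S) := ⟨by
    rw [Measure.restrict_apply_univ]; exact hb.measure_lt_top⟩
  set m := (volume.restrict S).real univ with hm
  have hm0 : 0 ≤ m := measureReal_nonneg
  refine ⟨L, 3 * N ^ 2 * (16 * m + L ^ 2), by positivity, ?_⟩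
  intro ε hε U W V f g hf hg hUf hWg hfg
  obtain ⟨Φ, hΦ, hL, hΦ0, hΦd⟩ := hLΦ ε hε
  have hc : ∀ {u : E N → E N}, ContinuousOn u (closure S) → ∀ j,
      ContinuousOn (fun x => u x j) (closure S) := fun hu j =>
    (EuclideanSpace.proj j : E N →L[ℝ] ℝ).continuous.comp_continuousOn hu
  have hex := fun j : Fin N => exists_isTest_near hS hb hε hΦ hL hΦ0 (hc hf j) (hc hg j)
    (fun x hx => (hfg x hx).imp (fun h => by rw [h]; rfl) (fun h => by rw [h]; rfl))
    (v := fun i : Fin N => e i) (F := fun i x => grad U x (i, j)) (G := fun i x => grad W x (i, j))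
    (fun i => memLp_coord (grad U) (i, j)) (fun i => memLp_coord (grad W) (i, j))
    (fun φ hφ i => ((isWeakGrad_grad U).congr_ae hUf (ae_eq_refl _)) φ hφ i j)
    (fun φ hφ i => ((isWeakGrad_grad W).congr_ae hWg (ae_eq_refl _)) φ hφ i j)
  choose ψ hψ hψΦ hψg using hex
  let φ : E N → E N := fun x => WithLp.toLp 2 fun j => ψ j x
  have hφ : IsTest S φ := IsTest.of_coord hψ
  have hval : val (hφ.toH1 hS) =ᵐ[volume.restrict S] φ := val_mkH1 _ _ _
  refine ⟨hφ.toH1 hS, hφ.toH1_mem hS, ?_, ?_⟩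
  · have hgr := hφ.grad_ae_eq hS hval
    rw [norm_sq_Lp_coord, norm_sq_Lp_coord, norm_sq_Lp_coord, ← Finset.sum_add_distrib,
      Finset.mul_sum]
    refine Finset.sum_le_sum fun q _ => ?_
    have : ∫ x in S, grad (hφ.toH1 hS) x q ^ 2 = ∫ x in S, fderiv ℝ (ψ q.2) x (e q.1) ^ 2 := by
      refine integral_congr_ae ?_
      filter_upwards [hgr] with x hx
      rw [hx]
      congr 1
      exact (fderiv_coord (hφ.1.differentiable (by simp) x) (e q.1) q.2).symm
    rw [this]
    exact hψg q.2 q.1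
  · have pt : ∀ᵐ x ∂(volume.restrict S), ‖(val (hφ.toH1 hS) - val V) x‖ ^ 2 ≤
        3 * N ^ 2 * (16 * ε ^ 2 + L ^ 2 * ‖(val U - val V) x‖ ^ 2
          + L ^ 2 * ‖(val W - val V) x‖ ^ 2) := by
      filter_upwards [hval, hUf, hWg, Lp.coeFn_sub (val (hφ.toH1 hS)) (val V),
        Lp.coeFn_sub (val U) (val V), Lp.coeFn_sub (val W) (val V),
        ae_restrict_mem hS.measurableSet] with x h1 h2 h3 h4 h5 h6 hx
      rw [h4, h5, h6, Pi.sub_apply, Pi.sub_apply, Pi.sub_apply, h1, h2, h3]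
      set a := ‖f x - val V x‖
      set b := ‖g x - val V x‖
      -- The `4 ε` is `ε` from replacing `ψ` by `Φ(f, g)` and `3 ε` from the defect of `Φ` on the
      -- diagonal.
      have hj : ∀ j, |(φ x - val V x) j| ≤ 4 * ε + L * a + L * b := by
        intro j
        have k1 := hψΦ j x hx
        have k2 := hL.dist_le_mul (f x j, g x j) (val V x j, val V x j)
        rw [Real.dist_eq] at k2
        have k3 := hΦd (val V x j)
        have k4 : |f x j - val V x j| ≤ a := PiLp.norm_apply_le (f x - val V x) j
        have k5 : |g x j - val V x j| ≤ b := PiLp.norm_apply_le (g x - val V x) j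
        have k6 : dist (f x j, g x j) (val V x j, val V x j) ≤ a + b :=
          max_le (k4.trans (le_add_of_nonneg_right (norm_nonneg _)))
            (k5.trans (le_add_of_nonneg_left (norm_nonneg _)))
        have k7 := mul_le_mul_of_nonneg_left k6 L.2
        have k8 := abs_sub_le (ψ j x) (Φ (f x j, g x j)) (val V x j)
        have k9 := abs_sub_le (Φ (f x j, g x j)) (Φ (val V x j, val V x j)) (val V x j)
        change |ψ j x - val V x j| ≤ _
        change (L : ℝ) * _ ≤ L * _ at k7
        linarith
      have hn : ‖φ x - val V x‖ ≤ N * (4 * ε + L * a + L * b) := by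
        refine (norm_le_sum_abs _).trans ((Finset.sum_le_sum fun j _ => hj j).trans_eq ?_)
        rw [Finset.sum_const, Finset.card_univ, Fintype.card_fin, nsmul_eq_mul]
      have hsq := pow_le_pow_left₀ (norm_nonneg _) hn 2
      refine hsq.trans ?_
      rw [mul_pow, mul_comm (3 : ℝ), mul_assoc]
      refine mul_le_mul_of_nonneg_left ?_ (sq_nonneg _)
      -- The inequality `(x + y + z)² ≤ 3 (x² + y² + z²)`, which explains the factor `3`.
      nlinarith [sq_nonneg (4 * ε - L * a), sq_nonneg (4 * ε - L * b), sq_nonneg (L * a - L * b)]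
    have i1 : Integrable (fun x => ‖(val U - val V) x‖ ^ 2) (volume.restrict S) :=
      (Lp.memLp (val U - val V)).integrable_norm_pow two_ne_zero
    have i2 : Integrable (fun x => ‖(val W - val V) x‖ ^ 2) (volume.restrict S) :=
      (Lp.memLp (val W - val V)).integrable_norm_pow two_ne_zero
    have i3 : Integrable (fun x => ‖(val (hφ.toH1 hS) - val V) x‖ ^ 2) (volume.restrict S) :=
      (Lp.memLp (val (hφ.toH1 hS) - val V)).integrable_norm_pow two_ne_zero
    have i4 : Integrable (fun x => 16 * ε ^ 2 + L ^ 2 * ‖(val U - val V) x‖ ^ 2)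
        (volume.restrict S) := (integrable_const _).add (i1.const_mul _)
    rw [norm_sq_Lp (val (hφ.toH1 hS) - val V)]
    refine (integral_mono_ae i3 ((i4.add (i2.const_mul _)).const_mul _) pt).trans ?_
    have q : ∀ u : L2 S (E N), ∫ x in S, (L : ℝ) ^ 2 * ‖u x‖ ^ 2 = L ^ 2 * ‖u‖ ^ 2 := fun u => by
      rw [integral_const_mul, norm_sq_Lp]
    rw [integral_const_mul]
    simp only [Pi.add_apply]
    rw [integral_add i4 (i2.const_mul _),
      integral_add (integrable_const _) (i1.const_mul _), q, q, integral_const,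
      smul_eq_mul, ← hm, mul_assoc (3 * (N : ℝ) ^ 2)]
    refine mul_le_mul_of_nonneg_left ?_ (by positivity)
    have key : ∀ a b : ℝ, m * (16 * ε ^ 2) + L ^ 2 * a ^ 2 + L ^ 2 * b ^ 2 ≤
        (16 * m + L ^ 2) * (ε ^ 2 + a ^ 2 + b ^ 2) := fun a b => by
      have p1 := mul_nonneg hm0 (sq_nonneg a)
      have p2 := mul_nonneg hm0 (sq_nonneg b)
      have p3 := mul_nonneg (sq_nonneg (L : ℝ)) (sq_nonneg ε)
      linarith
    exact key _ _

set_option maxHeartbeats 1000000 in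
/-- A field of `H¹(S)` that vanishes on two sets covering `∂S`, each in the sense of `H¹`, is in
`H¹₀(S)`. -/
theorem mem_H10sub_of_hasBoundaryValues (hS : IsOpen S) (hb : Bornology.IsBounded S)
    {A B : Set (E N)} (hAB : frontier S ⊆ A ∪ B) {V : H1 S} (hA : HasBoundaryValues A V 0)
    (hB : HasBoundaryValues B V 0) : V ∈ H10sub S := by
  obtain ⟨L, C, hC0, hLC⟩ := exists_mem_testSub_near hS hb
  have hpos : ∀ n : ℕ, (0 : ℝ) < 1 / (n + 1) := fun n => Nat.one_div_pos_of_nat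
  have step : ∀ n : ℕ, ∃ w ∈ testSub S, ‖grad w‖ ^ 2 ≤ L ^ 2 * (2 * (‖V‖ + 1) ^ 2) ∧
      ‖val w - val V‖ ^ 2 ≤ C * 3 * (1 / ((n : ℝ) + 1)) ^ 2 := by
    intro n
    obtain ⟨U, ⟨f, hf, hUf, hfA⟩, hU⟩ := Metric.mem_closure_iff.1 hA _ (hpos n)
    obtain ⟨W, ⟨g, hg, hWg, hgB⟩, hW⟩ := Metric.mem_closure_iff.1 hB _ (hpos n)
    obtain ⟨w, hw, h1, h2⟩ := hLC _ (hpos n) U W V f g hf hg hUf hWg fun x hx =>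
      (hAB hx).imp (hfA x) (hgB x)
    have val_le : ∀ X : H1 S, ‖val X‖ ^ 2 ≤ ‖X‖ ^ 2 := fun X => by
      rw [norm_sq_H1]; linarith [sq_nonneg ‖grad X‖]
    have grad_le : ∀ X : H1 S, ‖grad X‖ ^ 2 ≤ ‖X‖ ^ 2 := fun X => by
      rw [norm_sq_H1]; linarith [sq_nonneg ‖val X‖]
    have le1 : (1 : ℝ) / (n + 1) ≤ 1 := by
      rw [div_le_one (by positivity)]; linarith [Nat.cast_nonneg (α := ℝ) n]
    have bnd : ∀ X : H1 S, dist V X < 1 / ((n : ℝ) + 1) → ‖grad X‖ ^ 2 ≤ (‖V‖ + 1) ^ 2 ∧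
        ‖val X - val V‖ ^ 2 ≤ (1 / ((n : ℝ) + 1)) ^ 2 := by
      intro X hX
      rw [dist_comm, dist_eq_norm] at hX
      constructor
      · refine (grad_le X).trans (pow_le_pow_left₀ (norm_nonneg _) ?_ 2)
        linarith [norm_sub_norm_le X V]
      · exact (val_le (X - V)).trans (pow_le_pow_left₀ (norm_nonneg _) hX.le 2)
    refine ⟨w, hw, h1.trans (mul_le_mul_of_nonneg_left ?_ (sq_nonneg _)), h2.trans ?_⟩
    · linarith [(bnd U hU).1, (bnd W hW).1]
    · rw [mul_assoc]
      refine mul_le_mul_of_nonneg_left ?_ hC0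
      linarith [(bnd U hU).2, (bnd W hW).2]
  choose w hw hgw hvw using step
  have hlim : Tendsto (fun n => valL S (w n)) atTop (𝓝 (valL S V)) := by
    rw [tendsto_iff_norm_sub_tendsto_zero]
    have h0 : Tendsto (fun n : ℕ => Real.sqrt (C * 3) * (1 / ((n : ℝ) + 1))) atTop (𝓝 0) := by
      simpa using (tendsto_one_div_add_atTop_nhds_zero_nat (𝕜 := ℝ)).const_mul (Real.sqrt (C * 3))
    refine squeeze_zero (fun n => norm_nonneg _) (fun n => ?_) h0
    have h1 : (0 : ℝ) ≤ Real.sqrt (C * 3) * (1 / ((n : ℝ) + 1)) :=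
      mul_nonneg (Real.sqrt_nonneg _) (hpos n).le
    have h2 : ‖val (w n) - val V‖ ^ 2 ≤ (Real.sqrt (C * 3) * (1 / ((n : ℝ) + 1))) ^ 2 := by
      rw [mul_pow, Real.sq_sqrt (mul_nonneg hC0 zero_le_three)]
      exact hvw n
    exact (pow_le_pow_iff_left₀ (norm_nonneg _) h1 two_ne_zero).1 h2
  obtain ⟨M, hM⟩ := (hlim.norm).bddAbove_range
  -- The fields `w n` converge to `V` in `L²` and are bounded in `H¹`, so `V` is their weak limit.
  refine mem_of_bounded_of_tendsto (H10sub S) (valL S) (valL_injective hS)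
    (fun n => subset_closure (hw n)) (M := Real.sqrt (M ^ 2 + L ^ 2 * (2 * (‖V‖ + 1) ^ 2)))
    (fun n => ?_) hlim
  refine Real.le_sqrt_of_sq_le ?_
  rw [norm_sq_H1]
  exact add_le_add (pow_le_pow_left₀ (norm_nonneg _) (hM ⟨n, rfl⟩) 2) (hgw n)

theorem HasBoundaryValues.congr {T : Set (E N)} {U : H1 S} {g h : E N → E N}
    (hU : HasBoundaryValues T U g) (hgh : EqOn g h T) : HasBoundaryValues T U h := by
  refine closure_mono ?_ hU
  rintro Φ ⟨f, h1, h2, h3⟩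
  exact ⟨f, h1, h2, fun x hx => (h3 x hx).trans (hgh hx)⟩

theorem HasBoundaryValues.sub {T : Set (E N)} {U Λ : H1 S} {g lam : E N → E N}
    (hU : HasBoundaryValues T U g) (hc : ContinuousOn lam (closure S))
    (hΛ : val Λ =ᵐ[volume.restrict S] lam) :
    HasBoundaryValues T (U - Λ) (g - lam) := by
  refine map_mem_closure (f := fun X : H1 S => X - Λ) (continuous_id.sub continuous_const) hU ?_
  rintro Φ ⟨f, h1, h2, h3⟩
  refine ⟨f - lam, h1.sub hc, ?_, fun x hx => by simp [h3 x hx]⟩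
  exact (Lp.coeFn_sub (val Φ) (val Λ)).trans (h2.sub hΛ)

/-- Test fields vanish on `∂S`, so adding one to `lam` leaves the boundary values unchanged; the
closure defining `H¹₀(S)` does the rest. -/
theorem hasBoundaryValues_add (hS : IsOpen S) {T : Set (E N)} (hT : T ⊆ frontier S) {Λ V : H1 S}
    {lam : E N → E N} (hc : ContinuousOn lam (closure S))
    (hΛ : val Λ =ᵐ[volume.restrict S] lam) (hV : V ∈ H10 S) :
    HasBoundaryValues T (Λ + V) lam := by
  refine map_mem_closure (f := fun X : H1 S => Λ + X) (continuous_const.add continuous_id) hV ?_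
  rintro Φ ⟨φ, hφ, hΦ⟩
  refine ⟨lam + φ, hc.add hφ.1.continuous.continuousOn,
    (Lp.coeFn_add (val Λ) (val Φ)).trans (hΛ.add hΦ), fun x hx => ?_⟩
  have hxS : x ∉ S := by
    have := hT hx
    rw [hS.frontier_eq] at this
    exact this.2
  rw [Pi.add_apply, image_eq_zero_of_notMem_tsupport fun h => hxS (hφ.2.2 h), add_zero]

end BoundaryValues

/-! ### The lift of the boundary datum and the affine reduction -/

section Admissible

variable {N : ℕ} {D S : Set (E N)} {lam : E N → E N}

theorem IsC2OnClosure.contDiffOn_one (h : IsC2OnClosure D lam) (hSD : S ⊆ D) :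
    ContDiffOn ℝ 1 lam S := (h.1.mono hSD).of_le one_le_two

theorem IsC2OnClosure.memLp (h : IsC2OnClosure D lam) (hb : Bornology.IsBounded D)
    (hS : IsOpen S) (hSD : S ⊆ D) : MemLp lam 2 (volume.restrict S) := by
  have : IsFiniteMeasure (volume.restrict S) := ⟨by
    rw [Measure.restrict_apply_univ]; exact (hb.subset hSD).measure_lt_top⟩
  obtain ⟨C, hC⟩ := hb.isCompact_closure.exists_bound_of_continuousOn h.2.1
  refine MemLp.of_bound ((h.contDiffOn_one hSD).continuousOn.aestronglyMeasurable
    hS.measurableSet) C ?_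
  exact (ae_restrict_iff' hS.measurableSet).2
    (Eventually.of_forall fun x hx => hC x (subset_closure (hSD hx)))

/-- The first derivative extends continuously to a compact set, hence is bounded on the
finite-measure set `S`. -/
theorem IsC2OnClosure.memLp_gradMat (h : IsC2OnClosure D lam) (hb : Bornology.IsBounded D)
    (hS : IsOpen S) (hSD : S ⊆ D) : MemLp (gradMat lam) 2 (volume.restrict S) := by
  have : IsFiniteMeasure (volume.restrict S) := ⟨by
    rw [Measure.restrict_apply_univ]; exact (hb.subset hSD).measure_lt_top⟩
  obtain ⟨g, hg, hgD⟩ := h.2.2 1 one_le_two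
  obtain ⟨C, hC⟩ := hb.isCompact_closure.exists_bound_of_continuousOn hg
  refine memLp_of_apply fun q => MemLp.of_bound (ContinuousOn.aestronglyMeasurable ?_
    hS.measurableSet) (C * ‖(e q.1 : E N)‖) ?_
  · exact (EuclideanSpace.proj q.2 : E N →L[ℝ] ℝ).continuous.comp_continuousOn
      (((h.contDiffOn_one hSD).continuousOn_fderiv_of_isOpen hS le_rfl).clm_apply
        continuousOn_const)
  · refine (ae_restrict_iff' hS.measurableSet).2 (Eventually.of_forall fun x hx => ?_)
    have h1 := hC x (subset_closure (hSD hx))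
    rw [hgD (hSD hx), norm_iteratedFDeriv_one] at h1
    exact (PiLp.norm_apply_le (fderiv ℝ lam x (e q.1)) q.2).trans
      ((fderiv ℝ lam x).le_of_opNorm_le h1 _)

/-- The right-hand side `W ↦ ∫ q : ∇W` as a continuous linear functional on `H¹(S)`. -/
def gradFunctional {q : E N → Mat N} (hq : MemLp q 2 (volume.restrict S)) : H1 S →L[ℝ] ℝ :=
  (innerSL ℝ (hq.toLp q)).comp (gradL S)

theorem integrable_contract {a b : E N → Mat N} (ha : MemLp a 2 (volume.restrict S))
    (hb : MemLp b 2 (volume.restrict S)) :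
    Integrable (fun x => contract (a x) (b x)) (volume.restrict S) :=
  integrable_finsetSum _ fun i _ => integrable_finsetSum _ fun j _ =>
    (memLp_apply ha (i, j)).integrable_mul (memLp_apply hb (i, j))

theorem gradFunctional_apply {q : E N → Mat N} (hq : MemLp q 2 (volume.restrict S)) (W : H1 S) :
    gradFunctional hq W = ∫ x in S, contract (q x) (grad W x) := by
  change inner ℝ (hq.toLp q) (grad W) = _
  rw [L2.inner_def]
  refine integral_congr_ae ?_
  filter_upwards [hq.coeFn_toLp] with x hx
  rw [hx, contract_eq_inner]

theorem memLp_elasticPart (k G : ℝ) {a : E N → Mat N} (ha : MemLp a 2 (volume.restrict S)) :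
    MemLp (fun x => elasticPart k G (a x)) 2 (volume.restrict S) :=
  (elasticL N k G).comp_memLp' ha

theorem contract_stress_add (p k G : ℝ) (a b c : Mat N) :
    contract (stress p k G (a + b)) c =
      contract (elasticPart k G b) c - contract (p • idMat N - elasticPart k G a) c := by
  simp only [stress, contract_eq_inner, ← elasticL_apply, map_add, inner_add_left,
    inner_sub_left, inner_neg_left]
  ring

/-- The weak equation for `Λ + V` is exactly the homogeneous equation for `V`. Both the existence
and the uniqueness of `U` are transferred through this identity. -/
theorem integral_contract_stress_add (p k G : ℝ) {a : E N → Mat N}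
    (hq : MemLp (fun x => p • idMat N - elasticPart k G (a x)) 2 (volume.restrict S))
    {Λ : H1 S} (hΛ : grad Λ =ᵐ[volume.restrict S] a) (V W : H1 S) :
    ∫ x in S, contract (stress p k G (grad (Λ + V) x)) (grad W x) =
      energyForm S k G V W - gradFunctional hq W := by
  rw [energyForm_eq_integral, gradFunctional_apply,
    ← integral_sub (integrable_contract (memLp_elasticPart k G (Lp.memLp _)) (Lp.memLp _))
      (integrable_contract hq (Lp.memLp _))]
  refine integral_congr_ae ?_
  filter_upwards [hΛ, Lp.coeFn_add (grad Λ) (grad V)] with x h1 h2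
  have h3 : grad (Λ + V) x = a x + grad V x := by
    rw [← h1]; exact h2
  rw [h3, contract_stress_add]

end Admissible

end PoreElasticity

end

/-! ### The main theorem -/

open PoreElasticity in
set_option maxHeartbeats 1000000 in
theorem theorem1 {N : ℕ} [NeZero N] (hN : N = 2 ∨ N = 3) (C : PoreElasticity.RefConfig N)
    (p k G : ℝ) (hk : 0 < k) (hG : 0 < G) (hkG : 0 ≤ k - 2 / 3 * G)
    (lam : PoreElasticity.E N → PoreElasticity.E N) (hlam : lam ∈ C.Admissible) :
    ∃ U V : PoreElasticity.H1 C.S,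
      PoreElasticity.IsWeakSolution C p k G lam U ∧
      (∀ U', PoreElasticity.IsWeakSolution C p k G lam U' → U' = U) ∧
      PoreElasticity.SolvesHomogeneous C p k G lam V ∧
      (∀ V', PoreElasticity.SolvesHomogeneous C p k G lam V' → V' = V) ∧
      ∀ᵐ x ∂(volume.restrict C.S), PoreElasticity.val U x = lam x + PoreElasticity.val V x := by
  obtain ⟨hC2, hlam0, -⟩ := hlam
  have hSD : C.S ⊆ C.D := sdiff_subset
  have hS : IsOpen C.S := C.isOpen_D.sdiff isClosed_closure
  have hb : Bornology.IsBounded C.S := C.bounded_D.subset hSD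
  obtain ⟨R, hR⟩ := hb.exists_norm_le
  have hR' : ∀ x ∈ C.S, |x 0| ≤ R := fun x hx => (PiLp.norm_apply_le x 0).trans (hR x hx)
  have hfr : frontier C.S = C.Z ∪ C.Sig ∪ C.Γ ∪ C.Pi := C.frontier_S
  have hT1 : C.Z ∪ C.Sig ∪ C.Pi ⊆ frontier C.S := by
    rw [hfr]; rintro x ((h | h) | h) <;> simp [h]
  have hT2 : C.Γ ⊆ frontier C.S := by
    rw [hfr]; intro x h; simp [h]
  have hT : frontier C.S ⊆ (C.Z ∪ C.Sig ∪ C.Pi) ∪ C.Γ := by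
    rw [hfr]; rintro x (((h | h) | h) | h) <;> simp [h]
  have hT1D : C.Z ∪ C.Sig ∪ C.Pi ⊆ frontier C.D := by
    rw [C.frontier_D]; rintro x ((h | h) | h) <;> simp [h]
  -- These pieces lie in `∂D`, where `lam` vanishes, so a single lift `Λ` serves both boundary
  -- conditions.
  have hlam1 : EqOn lam 0 (C.Z ∪ C.Sig ∪ C.Pi) := fun x hx => hlam0 x (hT1D hx)
  have hcont : ContinuousOn lam (closure C.S) := hC2.2.1.mono (closure_mono hSD)
  have hgm := hC2.memLp_gradMat C.bounded_D hS hSD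
  let Λ : H1 C.S := mkH1 (hC2.memLp C.bounded_D hS hSD) hgm
    (isWeakGrad_gradMat hS (hC2.contDiffOn_one hSD))
  have hΛ : val Λ =ᵐ[volume.restrict C.S] lam := val_mkH1 _ _ _
  have hΛg : grad Λ =ᵐ[volume.restrict C.S] gradMat lam := grad_mkH1 _ _ _
  have : IsFiniteMeasure (volume.restrict C.S) := ⟨by
    rw [Measure.restrict_apply_univ]; exact hb.measure_lt_top⟩
  have hq : MemLp (fun x => p • idMat N - elasticPart k G (gradMat lam x)) 2
      (volume.restrict C.S) := (memLp_const (p • idMat N)).sub (memLp_elasticPart k G hgm)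
  -- The closing `rfl` works because `H10` and `H10sub` are closures of the same set of test fields.
  have solves_iff : ∀ V : H1 C.S, SolvesHomogeneous C p k G lam V ↔
      V ∈ H10sub C.S ∧ ∀ W ∈ H10sub C.S, energyForm C.S k G V W = gradFunctional hq W := by
    intro V
    simp only [energyForm_eq_integral, gradFunctional_apply]
    rfl
  obtain ⟨V, hV, hVW⟩ := exists_energyForm_eq hS 0 hR' hG hkG (gradFunctional hq)
  have uniq : ∀ V', SolvesHomogeneous C p k G lam V' → V' = V := by
    intro V' hV'
    rw [solves_iff] at hV'
    exact eq_of_energyForm_eq hS 0 hR' hG hkG hV'.1 hV fun W hW =>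
      (hV'.2 W hW).trans (hVW W hW).symm
  refine ⟨Λ + V, V, ⟨fun W hW => ?_, ?_, ?_⟩, fun U' hU' => ?_, (solves_iff V).2 ⟨hV, hVW⟩, uniq, ?_⟩
  · rw [integral_contract_stress_add p k G hq hΛg, hVW W hW, sub_self]
  · exact (hasBoundaryValues_add hS hT1 hcont hΛ hV).congr hlam1
  · exact hasBoundaryValues_add hS hT2 hcont hΛ hV
  · obtain ⟨h1, h2, h3⟩ := hU'
    have hcancel : Λ + (U' - Λ) = U' := add_sub_cancel Λ U'
    -- The difference vanishes on the outer pieces and on `Γ` as two separate limits, and together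
    -- these sets cover `∂S`.
    have hm : U' - Λ ∈ H10sub C.S := by
      refine mem_H10sub_of_hasBoundaryValues hS hb hT
        ((h2.sub hcont hΛ).congr fun x hx => ?_) ((h3.sub hcont hΛ).congr fun x hx => ?_)
      · simp [hlam1 hx]
      · simp
    have hs : SolvesHomogeneous C p k G lam (U' - Λ) := by
      refine (solves_iff _).2 ⟨hm, fun W hW => ?_⟩
      have h4 := integral_contract_stress_add p k G hq hΛg (U' - Λ) W
      rw [hcancel, h1 W hW] at h4
      exact (sub_eq_zero.1 h4.symm)
    exact hcancel.symm.trans (congrArg (fun X => Λ + X) (uniq _ hs))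
  · filter_upwards [Lp.coeFn_add (val Λ) (val V), hΛ] with x h1 h2
    rw [← h2]
    exact h1
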